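/- Let $\Lambda$ be an undirected graph (loops and multiple edges are allowed) with vertex set $V$ and edge set $E(\Lambda)$, and let $\mu:V\to(0,\infty)$. Let $\vec\Lambda$ be the directed graph on $V$ which has one edge for each loop of $\Lambda$ and two opposite edges $\epsilon',\epsilon''$ for each edge $\epsilon$ that is not a loop; write $s,t$ for source and target. Put $\mathcal C=C_0(V)$ ($V$ discrete), with $p_\alpha$ the indicator function of $\alpha\in V$. Let $\mathcal F$ be the Fock space of the Cuntz–Krieger bimodule of $\vec\Lambda$: the Hilbert $\mathcal C$-module completion of the finitely supported functions on finite directed walks $w=\epsilon_1\otimes\cdots\otimes\epsilon_n$ in $\vec\Lambda$, where the vertices $p_\alpha$ are the walks of length $0$, with $\langle w'|w\rangle=\delta_{w,w'}\,p_{t(w)}$ and left action $p_\alpha w=\delta_{\alpha,s(w)}w$. For a directed edge $\epsilon$ let $L_+(\epsilon)w=\epsilon\otimes w$ if $t(\epsilon)=s(w)$, and $L_+(\epsilon)w=0$ otherwise; this is an adjointable operator. For a loop $\epsilon$ put $T_\epsilon=L_+(\epsilon)+L_+(\epsilon)^*$; for an edge that is not a loop put $$T_\epsilon=a\big(L_+(\epsilon')+L_+(\epsilon')^*\big)+a^{-1}\big(L_+(\epsilon'')+L_+(\epsilon'')^*\big),\qquad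 a=\Big(\tfrac{\mu(s(\epsilon'))}{\mu(t(\epsilon'))}\Big)^{1/4}.$$ Let $\mathcal S(\Lambda,\mu)$ be the C*-algebra of adjointable operators on $\mathcal F$ generated by $\mathcal C$ (acting on the left) and all $T_\epsilon$, and let $\mathcal S_\epsilon$ be the C*-subalgebra generated by $\mathcal C$ and $T_\epsilon$. Then for every $x\in\mathcal S(\Lambda,\mu)$ the sum $E(x)=\sum_{\alpha\in V}\langle p_\alpha|x\,p_\alpha\rangle$ converges (unconditionally) in the norm of $\mathcal C$, and $E$ is a conditional expectation of $\mathcal S(\Lambda,\mu)$ onto $\mathcal C$. Moreover: 1. $E$ is faithful on each $\mathcal S_\epsilon$: if $x\in\mathcal S_\epsilon$ and $E(x^*x)=0$, then $x=0$. 2. The algebras $\mathcal S_\epsilon$, $\epsilon\in E(\Lambda)$, are free with amalgamation over $\mathcal C$ with respect to $E$: if $n\ge1$, $x_k\in\mathcal S_{\epsilon_k}$, $E(x_k)=0$ for all $k$ and $\epsilon_k\ne\epsilon_{k+1}$ for all $k<n$, then $E(x_1\cdots x_n)=0$. Further, $E$ is faithful on $\mathcal S(\Lambda,\mu)$, and $\mathcal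 S(\Lambda,\mu)$ with $E$ is the reduced amalgamated free product over $\mathcal C$ of the $(\mathcal S_\epsilon,E|_{\mathcal S_\epsilon})$. That is, it is generated by $\mathcal C$ and the $\mathcal S_\epsilon$, and it has a faithful representation by adjointable operators on the free product Hilbert module $$\mathcal C\oplus\bigoplus_{n\ge1}\ \bigoplus_{\epsilon_1\neq\epsilon_2\neq\cdots\neq\epsilon_n}L^2(\mathcal S_{\epsilon_1},E)^\circ\otimes_{\mathcal C}\cdots\otimes_{\mathcal C}L^2(\mathcal S_{\epsilon_n},E)^\circ$$ which restricts on each $\mathcal S_\epsilon$ to the canonical left action, and for which $E$ is the compression to the summand $\mathcal C$. Here $L^2(\mathcal S_\epsilon,E)^\circ$ is the orthogonal complement of $\mathcal C$ in the Hilbert $\mathcal C$-module $L^2(\mathcal S_\epsilon,E)$. -/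

import Mathlib

open scoped ZeroAtInfty ENNReal InnerProductSpace Graph

noncomputable section

namespace FreeGraph

universe u v

set_option linter.unusedSectionVars false

/-! ### Adjointable operators on a Hilbert C*-module -/

section Adjointable

variable (A E : Type*) [NonUnitalCStarAlgebra A] [PartialOrder A] [StarOrderedRing A]
  [NormedAddCommGroup E] [NormedSpace ℂ E] [SMul A E] [CStarModule A E]

/-- The algebra `L(E)` of bounded adjointable operators on the Hilbert `A`-module `E`. -/
def adjointable : Subalgebra ℂ (E →L[ℂ] E) where
  carrier := {T | ∃ S : E →L[ℂ] E, ∀ x y : E, ⟪T x, y⟫_A = ⟪x, S y⟫_A}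
  mul_mem' := by
    rintro T T' ⟨S, hS⟩ ⟨S', hS'⟩
    exact ⟨S' * S, fun x y => by simp [hS, hS']⟩
  add_mem' := by
    rintro T T' ⟨S, hS⟩ ⟨S', hS'⟩
    exact ⟨S + S', fun x y => by simp [hS, hS']⟩
  algebraMap_mem' := fun c => ⟨algebraMap ℂ _ (star c), fun x y => by
    simp [Algebra.algebraMap_eq_smul_one]⟩

/-- The C*-algebra `L(E)` as a type. -/
def Adjointable : Type _ := adjointable A E

instance : NormedRing (Adjointable A E) := inferInstanceAs (NormedRing (adjointable A E))

instance : NormedAlgebra ℂ (Adjointable A E) :=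
  inferInstanceAs (NormedAlgebra ℂ (adjointable A E))

variable {A E}

lemma eq_of_inner_eq {x y : E} (h : ∀ z : E, ⟪z, x⟫_A = ⟪z, y⟫_A) : x = y := by
  rw [← sub_eq_zero, ← CStarModule.inner_self (A := A)]
  have := h (x - y)
  rw [CStarModule.inner_sub_right, this, sub_self]

instance : Star (Adjointable A E) where
  star T := ⟨T.2.choose, ⟨T.1, fun x y => by
    rw [← CStarModule.star_inner, ← T.2.choose_spec, CStarModule.star_inner]⟩⟩

lemma inner_apply_left (T : Adjointable A E) (x y : E) :
    ⟪T.1 x, y⟫_A = ⟪x, (star T).1 y⟫_A := T.2.choose_spec x y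

lemma inner_apply_right (T : Adjointable A E) (x y : E) :
    ⟪x, T.1 y⟫_A = ⟪(star T).1 x, y⟫_A := by
  rw [← CStarModule.star_inner, inner_apply_left, CStarModule.star_inner]

lemma star_eq_of_inner {T S : Adjointable A E}
    (h : ∀ x y : E, ⟪T.1 x, y⟫_A = ⟪x, S.1 y⟫_A) : star T = S := by
  refine Subtype.ext (ContinuousLinearMap.ext fun y => eq_of_inner_eq (A := A) fun z => ?_)
  rw [← inner_apply_left, h]

instance : StarRing (Adjointable A E) where
  star_involutive T := star_eq_of_inner fun x y => (inner_apply_right T x y).symm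
  star_mul T S := star_eq_of_inner fun x y => by
    change ⟪T.1 (S.1 x), y⟫_A = ⟪x, (star S).1 ((star T).1 y)⟫_A
    rw [inner_apply_left, inner_apply_left]
  star_add T S := star_eq_of_inner fun x y => by
    change ⟪T.1 x + S.1 x, y⟫_A = ⟪x, (star T).1 y + (star S).1 y⟫_A
    rw [CStarModule.inner_add_left, CStarModule.inner_add_right, inner_apply_left,
      inner_apply_left]

instance : StarModule ℂ (Adjointable A E) where
  star_smul c T := star_eq_of_inner fun x y => by
    change ⟪c • T.1 x, y⟫_A = ⟪x, star c • (star T).1 y⟫_A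
    rw [CStarModule.inner_smul_left_complex, CStarModule.inner_smul_right_complex,
      inner_apply_left]

instance : CStarRing (Adjointable A E) where
  norm_mul_self_le T := by
    have hn : 0 ≤ ‖star T * T‖ := norm_nonneg _
    have key : ∀ x : E, ‖T.1 x‖ ≤ √‖star T * T‖ * ‖x‖ := fun x => by
      have h1 : ‖T.1 x‖ ^ 2 ≤ ‖star T * T‖ * ‖x‖ ^ 2 := by
        rw [CStarModule.norm_sq_eq A, inner_apply_left]
        calc ‖⟪x, (star T).1 (T.1 x)⟫_A‖ ≤ ‖x‖ * ‖(star T).1 (T.1 x)‖ :=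
              CStarModule.norm_inner_le E
          _ ≤ ‖x‖ * (‖star T * T‖ * ‖x‖) := by
              gcongr
              exact (star T * T).1.le_opNorm x
          _ = ‖star T * T‖ * ‖x‖ ^ 2 := by ring
      calc ‖T.1 x‖ = √(‖T.1 x‖ ^ 2) := (Real.sqrt_sq (norm_nonneg _)).symm
        _ ≤ √(‖star T * T‖ * ‖x‖ ^ 2) := Real.sqrt_le_sqrt h1
        _ = √‖star T * T‖ * ‖x‖ := by
            rw [Real.sqrt_mul hn, Real.sqrt_sq (norm_nonneg _)]
    have h2 : ‖T‖ ≤ √‖star T * T‖ :=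
      T.1.opNorm_le_bound (Real.sqrt_nonneg _) key
    calc ‖T‖ * ‖T‖ ≤ √‖star T * T‖ * √‖star T * T‖ := by gcongr
      _ = ‖star T * T‖ := Real.mul_self_sqrt hn

lemma isClosed_adjointable [CompleteSpace E] :
    IsClosed (adjointable A E : Set (E →L[ℂ] E)) := by
  refine isClosed_of_closure_subset fun T hT => ?_
  obtain ⟨s, hs, hlim⟩ := mem_closure_iff_seq_limit.1 hT
  let t : ℕ → Adjointable A E := fun n => ⟨s n, hs n⟩
  have hc : CauchySeq fun n => (star (t n)).1 := by
    have hcs : CauchySeq s := hlim.cauchySeq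
    rw [Metric.cauchySeq_iff] at hcs ⊢
    intro ε hε
    obtain ⟨N, hN⟩ := hcs ε hε
    refine ⟨N, fun m hm n hn => ?_⟩
    have := hN m hm n hn
    rw [dist_eq_norm] at this ⊢
    have e : ‖star (t m) - star (t n)‖ = ‖t m - t n‖ := by
      rw [← star_sub, norm_star]
    calc _ = ‖star (t m) - star (t n)‖ := rfl
      _ = ‖t m - t n‖ := e
      _ < ε := this
  obtain ⟨S, hS⟩ := cauchySeq_tendsto_of_complete hc
  refine ⟨S, fun x y => ?_⟩
  have h1 : Filter.Tendsto (fun n => ⟪s n x, y⟫_A) Filter.atTop (nhds ⟪T x, y⟫_A) := by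
    have : Filter.Tendsto (fun n => (s n x, y)) Filter.atTop (nhds (T x, y)) :=
      (((ContinuousLinearMap.apply ℂ E x).continuous.tendsto T).comp hlim).prodMk_nhds
        tendsto_const_nhds
    exact (CStarModule.continuous_inner.tendsto _).comp this
  have h2 : Filter.Tendsto (fun n => ⟪x, (star (t n)).1 y⟫_A) Filter.atTop
      (nhds ⟪x, S y⟫_A) := by
    have : Filter.Tendsto (fun n => (x, (star (t n)).1 y)) Filter.atTop (nhds (x, S y)) :=
      tendsto_const_nhds.prodMk_nhds
        (((ContinuousLinearMap.apply ℂ E y).continuous.tendsto S).comp hS)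
    exact (CStarModule.continuous_inner.tendsto _).comp this
  exact tendsto_nhds_unique (h1.congr fun n => inner_apply_left (t n) x y) h2

instance [CompleteSpace E] : CStarAlgebra (Adjointable A E) where
  toCompleteSpace := isClosed_adjointable.completeSpace_coe

end Adjointable

/-! ### The Hilbert `C₀(X)`-module of `C₀`-sections of a family of Hilbert spaces -/

section C0Sum

variable {X : Type u} [TopologicalSpace X] [DiscreteTopology X]

/-- The order on `C₀(X)` (positive elements are those of the form `a⋆ a`). -/
instance : PartialOrder C₀(X, ℂ) := CStarAlgebra.spectralOrder _

instance : StarOrderedRing C₀(X, ℂ) := CStarAlgebra.spectralOrderedRing _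

/-- A function on a discrete space which vanishes at infinity, as an element of `C₀(X)`. -/
def mkC0 (f : X → ℂ) (hf : Filter.Tendsto f Filter.cofinite (nhds 0)) : C₀(X, ℂ) where
  toFun := f
  continuous_toFun := continuous_of_discreteTopology
  zero_at_infty' := by rwa [Filter.cocompact_eq_cofinite]

lemma tendsto_cofinite (f : C₀(X, ℂ)) : Filter.Tendsto f Filter.cofinite (nhds 0) := by
  rw [← Filter.cocompact_eq_cofinite X]
  exact f.zero_at_infty'

lemma norm_apply_le (f : C₀(X, ℂ)) (x : X) : ‖f x‖ ≤ ‖f‖ :=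
  f.toBCF.norm_coe_le_norm x

lemma norm_le_of_forall (f : C₀(X, ℂ)) {r : ℝ} (hr : 0 ≤ r) (h : ∀ x, ‖f x‖ ≤ r) : ‖f‖ ≤ r :=
  (BoundedContinuousFunction.norm_le hr (f := f.toBCF)).2 h

variable (H : X → Type v) [∀ x, NormedAddCommGroup (H x)] [∀ x, InnerProductSpace ℂ (H x)]

/-- The bounded families `ξ ∈ ∏ₓ H x` for which `x ↦ ‖ξ x‖` vanishes at infinity, with the
supremum norm. -/
def C0Sections : Submodule ℂ (lp H ∞) where
  carrier := {ξ | Filter.Tendsto (fun x => ‖ξ x‖) Filter.cofinite (nhds 0)}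
  add_mem' := fun {ξ η} h h' => squeeze_zero (fun _ => norm_nonneg _)
    (fun x => norm_add_le (ξ x) (η x)) (by simpa using Filter.Tendsto.add h h')
  zero_mem' := by
    change Filter.Tendsto (fun x => ‖(0 : lp H ∞) x‖) Filter.cofinite (nhds 0)
    simpa using tendsto_const_nhds
  smul_mem' := fun c ξ h => by
    have : Filter.Tendsto (fun x => ‖c‖ * ‖ξ x‖) Filter.cofinite (nhds (‖c‖ * 0)) :=
      Filter.Tendsto.const_mul _ h
    simpa [norm_smul] using this

variable {H}

/-- A family whose norms vanish at infinity, as an element of `C0Sections H`. -/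
def C0Sections.mk (f : ∀ x, H x)
    (hf : Filter.Tendsto (fun x => ‖f x‖) Filter.cofinite (nhds 0)) : C0Sections H :=
  ⟨⟨f, memℓp_infty (by
    let g : C₀(X, ℂ) := mkC0 (fun x => ((‖f x‖ : ℝ) : ℂ)) (by
      simpa [Function.comp_def] using (Complex.continuous_ofReal.tendsto 0).comp hf)
    refine ⟨‖g‖, ?_⟩
    rintro _ ⟨x, rfl⟩
    simpa [g, mkC0] using norm_apply_le g x)⟩, hf⟩

lemma C0Sections.ext {ξ η : C0Sections H} (h : ∀ x, ξ.1 x = η.1 x) : ξ = η :=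
  Subtype.ext (lp.ext (funext h))

lemma C0Sections.norm_apply_le (ξ : C0Sections H) (x : X) : ‖ξ.1 x‖ ≤ ‖ξ‖ :=
  lp.norm_apply_le_norm (by simp) ξ.1 x

lemma C0Sections.norm_le (ξ : C0Sections H) {r : ℝ} (hr : 0 ≤ r) (h : ∀ x, ‖ξ.1 x‖ ≤ r) :
    ‖ξ‖ ≤ r :=
  lp.norm_le_of_forall_le hr h

/-- The right action of `C₀(X)`. As `C₀(X)` is commutative it is written on the left, following
the convention of `CStarModule`. -/
instance : SMul C₀(X, ℂ) (C0Sections H) where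
  smul a ξ := C0Sections.mk (fun x => a x • ξ.1 x) (by
    have := (tendsto_cofinite a).norm.mul ξ.2
    simpa [norm_smul] using this)

/-- The `C₀(X)`-valued inner product `⟪ξ, η⟫ x = ⟪ξ x, η x⟫`. -/
def C0Sections.inner (ξ η : C0Sections H) : C₀(X, ℂ) :=
  mkC0 (fun x => ⟪ξ.1 x, η.1 x⟫_ℂ) (squeeze_zero_norm (fun x => norm_inner_le_norm _ _)
    (by simpa using Filter.Tendsto.mul ξ.2 η.2))

instance : CStarModule C₀(X, ℂ) (C0Sections H) where
  inner := C0Sections.inner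
  inner_add_right {ξ η ζ} := by
    ext x
    exact inner_add_right _ _ _
  inner_self_nonneg {ξ} := by
    let a : C₀(X, ℂ) := mkC0 (fun x => ((‖ξ.1 x‖ : ℝ) : ℂ)) (by
      simpa [Function.comp_def] using (Complex.continuous_ofReal.tendsto 0).comp ξ.2)
    have : C0Sections.inner ξ ξ = star a * a := by
      ext x
      change ⟪ξ.1 x, ξ.1 x⟫_ℂ = star ((‖ξ.1 x‖ : ℝ) : ℂ) * ((‖ξ.1 x‖ : ℝ) : ℂ)
      rw [inner_self_eq_norm_sq_to_K]
      simp [sq]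
    rw [this]
    exact star_mul_self_nonneg a
  inner_self {ξ} := by
    constructor
    · intro h
      refine C0Sections.ext fun x => ?_
      have : C0Sections.inner ξ ξ x = 0 := by rw [h]; rfl
      exact inner_self_eq_zero.1 this
    · rintro rfl
      ext x
      exact inner_zero_left _
  inner_op_smul_right {a ξ η} := by
    ext x
    exact inner_smul_right _ _ _
  inner_smul_right_complex {z ξ η} := by
    ext x
    exact inner_smul_right _ _ _
  star_inner ξ η := by
    ext x
    exact inner_conj_symm _ _
  norm_eq_sqrt_norm_inner_self ξ := by
    apply le_antisymm
    · refine C0Sections.norm_le ξ (Real.sqrt_nonneg _) fun x => Real.le_sqrt_of_sq_le ?_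
      have h := norm_apply_le (C0Sections.inner ξ ξ) x
      have h' : ‖C0Sections.inner ξ ξ x‖ = ‖ξ.1 x‖ ^ 2 := by
        change ‖⟪ξ.1 x, ξ.1 x⟫_ℂ‖ = _
        rw [inner_self_eq_norm_sq_to_K]
        simp
      rwa [h'] at h
    · refine Real.sqrt_le_iff.2 ⟨norm_nonneg _, norm_le_of_forall _ (by positivity) fun x => ?_⟩
      change ‖⟪ξ.1 x, ξ.1 x⟫_ℂ‖ ≤ _
      refine (norm_inner_le_norm _ _).trans ?_
      rw [← sq]
      gcongr
      exact C0Sections.norm_apply_le ξ x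

instance [∀ x, CompleteSpace (H x)] : CompleteSpace (C0Sections H) := by
  refine IsClosed.completeSpace_coe (hs := isClosed_of_closure_subset fun ξ hξ => ?_)
  change Filter.Tendsto (fun x => ‖ξ x‖) Filter.cofinite (nhds 0)
  rw [Metric.tendsto_nhds]
  intro ε hε
  obtain ⟨η, hη, hd⟩ := Metric.mem_closure_iff.1 hξ (ε / 2) (half_pos hε)
  filter_upwards [(Metric.tendsto_nhds.1 hη) (ε / 2) (half_pos hε)] with x hx
  simp only [dist_zero_right, norm_norm] at hx ⊢
  have h1 : ‖(ξ - η) x‖ ≤ ‖ξ - η‖ := lp.norm_apply_le_norm (by simp) _ x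
  rw [dist_eq_norm] at hd
  calc ‖ξ x‖ = ‖(ξ - η) x + η x‖ := by simp
    _ ≤ ‖(ξ - η) x‖ + ‖η x‖ := norm_add_le _ _
    _ < ε := by linarith

/-- A uniformly bounded family of operators `T x` on `H x` acts fibrewise on `C0Sections H`. -/
def fibrewise (T : ∀ x, H x →L[ℂ] H x) (C : ℝ) (hT : ∀ x, ‖T x‖ ≤ C) :
    C0Sections H →L[ℂ] C0Sections H :=
  LinearMap.mkContinuous
    { toFun := fun ξ => C0Sections.mk (fun x => T x (ξ.1 x))
        (squeeze_zero (fun _ => norm_nonneg _)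
          (fun x => (T x).le_of_opNorm_le (hT x) (ξ.1 x))
          (by simpa using Filter.Tendsto.const_mul C ξ.2))
      map_add' := fun ξ η => C0Sections.ext fun x => map_add (T x) _ _
      map_smul' := fun c ξ => C0Sections.ext fun x => map_smul (T x) _ _ }
    |C| fun ξ => C0Sections.norm_le _ (by positivity) fun x =>
      ((T x).le_of_opNorm_le ((hT x).trans (le_abs_self C)) (ξ.1 x)).trans
        (mul_le_mul_of_nonneg_left (C0Sections.norm_apply_le ξ x) (abs_nonneg C))

/-- The adjointable operator on `C0Sections H` given by a uniformly bounded family. -/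
def fibrewiseAdj [∀ x, CompleteSpace (H x)] (T : ∀ x, H x →L[ℂ] H x) (C : ℝ)
    (hT : ∀ x, ‖T x‖ ≤ C) : Adjointable C₀(X, ℂ) (C0Sections H) :=
  ⟨fibrewise T C hT, fibrewise (fun x => (T x).adjoint) C
    (fun x => by rw [LinearIsometryEquiv.norm_map]; exact hT x),
    fun ξ η => by
      ext x
      exact ((T x).adjoint_inner_right _ _).symm⟩

end C0Sum

/-! ### Operators on `ℓ²` -/

section EllTwo

variable {ι : Type*}

lemma partialComp_bound (f : ι → Option ι) (hf : ∀ i i' k, f i = some k → f i' = some k → i = i')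
    (g : ι → ℂ) (C : ℝ) (hC : 0 ≤ C) (hg : ∀ i, ‖g i‖ ≤ C) (ξ : lp (fun _ : ι => ℂ) 2)
    (s : Finset ι) :
    ∑ i ∈ s, ‖g i * (f i).elim 0 ξ‖ ^ (2 : ℝ≥0∞).toReal ≤ (C * ‖ξ‖) ^ (2 : ℝ≥0∞).toReal := by
  have h2 : (2 : ℝ≥0∞).toReal = 2 := by simp
  have hsum := lp.sum_rpow_le_norm_rpow (p := 2) (by simp) ξ (s.filterMap f (fun a a' b h h' => hf a a' b h h'))
  have key : ∑ i ∈ s, ‖(f i).elim 0 ξ‖ ^ (2 : ℝ≥0∞).toReal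
      = ∑ k ∈ s.filterMap f (fun a a' b h h' => hf a a' b h h'), ‖ξ k‖ ^ (2 : ℝ≥0∞).toReal := by
    classical
    induction s using Finset.induction_on with
    | empty => simp
    | insert a s ha ih =>
      have ih' := ih (lp.sum_rpow_le_norm_rpow (p := 2) (by simp) ξ _)
      rw [Finset.sum_insert ha, ih']
      cases hfa : f a with
      | none =>
        have : (insert a s).filterMap f (fun a a' b h h' => hf a a' b h h')
            = s.filterMap f (fun a a' b h h' => hf a a' b h h') := by
          ext k
          simp [Finset.mem_filterMap, hfa]
        rw [this]
        simp
      | some k =>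
        have : (insert a s).filterMap f (fun a a' b h h' => hf a a' b h h')
            = insert k (s.filterMap f (fun a a' b h h' => hf a a' b h h')) := by
          ext k'
          simp [Finset.mem_filterMap, hfa, eq_comm]
        rw [this, Finset.sum_insert]
        · simp
        · rw [Finset.mem_filterMap]
          rintro ⟨a', ha', h'⟩
          exact ha (hf a a' k hfa h' ▸ ha')
  calc ∑ i ∈ s, ‖g i * (f i).elim 0 ξ‖ ^ (2 : ℝ≥0∞).toReal
      ≤ ∑ i ∈ s, C ^ (2 : ℝ≥0∞).toReal * ‖(f i).elim 0 ξ‖ ^ (2 : ℝ≥0∞).toReal := by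
        refine Finset.sum_le_sum fun i _ => ?_
        rw [norm_mul, Real.mul_rpow (norm_nonneg _) (norm_nonneg _)]
        gcongr
        exact hg i
    _ = C ^ (2 : ℝ≥0∞).toReal * ∑ k ∈ s.filterMap f (fun a a' b h h' => hf a a' b h h'),
          ‖ξ k‖ ^ (2 : ℝ≥0∞).toReal := by rw [← Finset.mul_sum, key]
    _ ≤ C ^ (2 : ℝ≥0∞).toReal * ‖ξ‖ ^ (2 : ℝ≥0∞).toReal := by gcongr
    _ = (C * ‖ξ‖) ^ (2 : ℝ≥0∞).toReal := (Real.mul_rpow hC (norm_nonneg _)).symm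

/-- For a partially defined injective map `f` and a bounded function `g`, the operator on `ℓ²(ι)`
with `(T ξ) i = g i * ξ (f i)` where `f i` is defined, and `(T ξ) i = 0` elsewhere. -/
def partialComp (f : ι → Option ι) (hf : ∀ i i' k, f i = some k → f i' = some k → i = i')
    (g : ι → ℂ) (C : ℝ) (hC : 0 ≤ C) (hg : ∀ i, ‖g i‖ ≤ C) :
    lp (fun _ : ι => ℂ) 2 →L[ℂ] lp (fun _ : ι => ℂ) 2 :=
  LinearMap.mkContinuous
    { toFun := fun ξ => ⟨fun i => g i * (f i).elim 0 ξ,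
        memℓp_gen' (partialComp_bound f hf g C hC hg ξ)⟩
      map_add' := fun ξ η => lp.ext (funext fun i => by
        change g i * (f i).elim 0 (ξ + η) = g i * (f i).elim 0 ξ + g i * (f i).elim 0 η
        cases f i with
        | none => exact ((mul_zero _).trans (add_zero _).symm).trans (by simp)
        | some k => exact mul_add (g i) (ξ k) (η k))
      map_smul' := fun c ξ => lp.ext (funext fun i => by
        change g i * (f i).elim 0 (c • ξ) = c * (g i * (f i).elim 0 ξ)
        cases f i with
        | none => simp
        | some k => exact mul_left_comm (g i) c (ξ k)) }
    C fun ξ => lp.norm_le_of_forall_sum_le (by simp) (by positivity)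
      (partialComp_bound f hf g C hC hg ξ)

lemma partialComp_apply (f : ι → Option ι)
    (hf : ∀ i i' k, f i = some k → f i' = some k → i = i')
    (g : ι → ℂ) (C : ℝ) (hC : 0 ≤ C) (hg : ∀ i, ‖g i‖ ≤ C) (ξ : lp (fun _ : ι => ℂ) 2) (i : ι) :
    partialComp f hf g C hC hg ξ i = g i * (f i).elim 0 ξ := rfl

lemma norm_partialComp_le (f : ι → Option ι)
    (hf : ∀ i i' k, f i = some k → f i' = some k → i = i')
    (g : ι → ℂ) (C : ℝ) (hC : 0 ≤ C) (hg : ∀ i, ‖g i‖ ≤ C) :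
    ‖partialComp f hf g C hC hg‖ ≤ C :=
  LinearMap.mkContinuous_norm_le _ hC _

end EllTwo

/-! ### Freeness with amalgamation and reduced amalgamated free products

Throughout, `D` is a C*-algebra with an embedded commutative C*-algebra `j : B → D` and a map
`E : D → B`, which is used only on a C*-subalgebra of `D` containing `j B`. -/

section FreeProduct

variable {ι B : Type*} {D : Type u} [NonUnitalCommCStarAlgebra B] [PartialOrder B]
  [StarOrderedRing B] [CStarAlgebra D]

/-- `E` is faithful on `S`: if `x ∈ S` and `E (x⋆ x) = 0` then `x = 0`. -/
def IsFaithfulOn (E : D → B) (S : NonUnitalStarSubalgebra ℂ D) : Prop :=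
  ∀ x ∈ S, E (star x * x) = 0 → x = 0

/-- `E` restricts to a conditional expectation of `S` onto `B`. -/
structure IsConditionalExpectationOn (j : B →⋆ₙₐ[ℂ] D) (E : D → B)
    (S : NonUnitalStarSubalgebra ℂ D) : Prop where
  map_add : ∀ x ∈ S, ∀ y ∈ S, E (x + y) = E x + E y
  map_smul : ∀ (c : ℂ), ∀ x ∈ S, E (c • x) = c • E x
  map_base : ∀ b, E (j b) = b
  bimodule : ∀ b b', ∀ x ∈ S, E (j b * x * j b') = b * E x * b'
  nonneg : ∀ x ∈ S, 0 ≤ E (star x * x)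
  norm_le : ∀ x ∈ S, ‖E x‖ ≤ ‖x‖

/-- A word `(i₁, x₁), …, (iₙ, xₙ)` with `x_k ∈ A (i_k)`, `E x_k = 0` and `i_k ≠ i_{k+1}`. -/
def IsReducedWord (A : ι → NonUnitalStarSubalgebra ℂ D) (E : D → B) (w : List (ι × D)) : Prop :=
  (∀ p ∈ w, p.2 ∈ A p.1 ∧ E p.2 = 0) ∧ w.IsChain fun p q => p.1 ≠ q.1

/-- The family `A` is free with amalgamation with respect to `E`. -/
def IsFreeWithAmalgamation (A : ι → NonUnitalStarSubalgebra ℂ D) (E : D → B) : Prop :=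
  ∀ w : List (ι × D), w ≠ [] → IsReducedWord A E w → E (w.map Prod.snd).prod = 0

open Classical in
/-- The `B`-valued inner product `⟪x₁ ⊗ ⋯ ⊗ xₙ b, c • (y₁ ⊗ ⋯ ⊗ yₘ b')⟫`, namely
`b⋆ E(xₙ⋆ ⋯ E(x₂⋆ E(x₁⋆ c y₁) y₂) ⋯ yₙ) b'` if `m = n` and the two words have the same indices,
and zero otherwise. -/
def wordInner (j : B →⋆ₙₐ[ℂ] D) (E : D → B) (b b' : B) :
    List (ι × D) → List (ι × D) → D → B
  | [], [], c => E (star (j b) * c * j b')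
  | (i, x) :: w, (k, y) :: w', c =>
    if i = k then wordInner j E b b' w w' (j (E (star x * c * y))) else 0
  | _, _, _ => 0

section Model

variable (j : B →⋆ₙₐ[ℂ] D) (E : D → B) {M : Type*} [AddCommGroup M] (vec : List (ι × D) → B → M)

/-- The left multiplication by `c ∈ B` on the vectors `x₁ ⊗ ⋯ ⊗ xₙ b`. -/
def baseAction (c : B) : List (ι × D) → B → M
  | [], b => vec [] (c * b)
  | (k, x) :: w, b => vec ((k, j c * x) :: w) b

open Classical in
/-- The left action of `a ∈ A i` on the vectors `x₁ ⊗ ⋯ ⊗ xₙ b`, where `a° = a - E(a)`: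
`a (x₁ ⊗ w) = (a x₁)° ⊗ w + E(a x₁) w` if `x₁ ∈ A i`, and `a w = a° ⊗ w + E(a) w` if `w` does not
start with an element of `A i`. -/
def factorAction (i : ι) (a : D) : List (ι × D) → B → M
  | [], b => vec [(i, a - j (E a))] b + baseAction j vec (E a) [] b
  | (k, x) :: w, b =>
    if k = i then vec ((i, a * x - j (E (a * x))) :: w) b + baseAction j vec (E (a * x)) w b
    else vec ((i, a - j (E a)) :: (k, x) :: w) b + baseAction j vec (E a) ((k, x) :: w) b

end Model

/-- `S`, with the conditional expectation `E`, is the reduced amalgamated free product over `B` of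
its C*-subalgebras `A i` with the restrictions of `E`. That is, `S` is generated by `B` and the
`A i`, and it has a faithful representation `π` as adjointable operators on the free product of
the Hilbert `B`-modules `L²(A i, E) = B ⊕ L²(A i, E)°`, the Hilbert `B`-module
`M = B ⊕ ⨁ L²(A i₁, E)° ⊗_B ⋯ ⊗_B L²(A iₙ, E)°` (the sum is over `n ≥ 1` and
`i₁ ≠ i₂ ≠ ⋯ ≠ iₙ`), such that `π` restricts on each `A i` to the canonical left action and that
`E` is the compression to the summand `B` of `M`. The module `M` is determined up to isomorphism
by the inner products of the vectors `vec w b = x₁ ⊗ ⋯ ⊗ xₙ b`, which span a dense subspace. -/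
def IsReducedFreeProduct (j : B →⋆ₙₐ[ℂ] D) (E : D → B) (A : ι → NonUnitalStarSubalgebra ℂ D)
    (S : NonUnitalStarSubalgebra ℂ D) : Prop :=
  Function.Injective j ∧
  (∀ i, IsClosed (A i : Set D) ∧ Set.range j ⊆ (A i : Set D)) ∧
  S = (NonUnitalStarAlgebra.adjoin ℂ
    (Set.range j ∪ ⋃ i, (A i : Set D))).topologicalClosure ∧
  IsConditionalExpectationOn j E S ∧
  ∃ (M : Type u) (_ : NormedAddCommGroup M) (_ : NormedSpace ℂ M) (_ : CompleteSpace M)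
    (_ : SMul B M) (_ : CStarModule B M) (vec : List (ι × D) → B → M),
    (∀ w w', IsReducedWord A E w → IsReducedWord A E w' → ∀ b b',
      ⟪vec w b, vec w' b'⟫_B = wordInner j E b b' w w' 1) ∧
    closure (Submodule.span ℂ {ξ | ∃ w b, IsReducedWord A E w ∧ ξ = vec w b} : Set M)
      = Set.univ ∧
    ∃ π : S →⋆ₙₐ[ℂ] Adjointable B M,
      Function.Injective π ∧
      (∀ (c : B) (x : S), (x : D) = j c →
        ∀ w, IsReducedWord A E w → ∀ b, (π x).1 (vec w b) = baseAction j vec c w b) ∧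
      (∀ (i : ι) (x : S), (x : D) ∈ A i →
        ∀ w, IsReducedWord A E w → ∀ b, (π x).1 (vec w b) = factorAction j E vec i x w b) ∧
      (∀ (x : S) (b b' : B), ⟪vec [] b, (π x).1 (vec [] b')⟫_B = star b * E x * b')

end FreeProduct

/-! ### The directed graph of an undirected graph and its Fock space -/

section Graph

variable {α : Type u} {β : Type v}

/-- The vertices of the undirected graph `Λ` (loops and multiple edges are allowed), as a
discrete space. -/
def Vert (Λ : Graph α β) : Type u := V(Λ)

/-- The edges of `Λ`. -/
def Edge (Λ : Graph α β) : Type v := E(Λ)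

variable {Λ : Graph α β}

instance : TopologicalSpace (Vert Λ) := ⊥

instance : DiscreteTopology (Vert Λ) := ⟨rfl⟩

variable (Λ) in
/-- The edges of the directed graph associated with `Λ`: an edge of `Λ` together with an ordering
of its two ends. A loop gives one directed edge, every other edge gives two. -/
@[ext]
structure DirEdge where
  edge : Edge Λ
  src : Vert Λ
  tgt : Vert Λ
  isLink : Λ.IsLink edge.1 src.1 tgt.1

/-- The directed edges which come from the edge `e`. -/
def DirEdge.Over (e : Edge Λ) : Type (max u v) := {d : DirEdge Λ // d.edge = e}

instance (e : Edge Λ) : Finite (DirEdge.Over e) := by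
  obtain ⟨x, y, h⟩ := Λ.exists_isLink_of_mem_edgeSet e.2
  let X : Vert Λ := ⟨x, h.left_mem⟩
  let Y : Vert Λ := ⟨y, h.right_mem⟩
  refine Finite.of_injective (β := Set.Elem ({X, Y} ×ˢ {X, Y} : Set (Vert Λ × Vert Λ)))
    (fun d => ⟨(d.1.src, d.1.tgt), ?_⟩) ?_
  · obtain ⟨⟨e', s, t, hl⟩, rfl⟩ := d
    have h1 := hl.left_eq_or_eq h
    have h2 := hl.right_eq_or_eq h
    refine ⟨?_, ?_⟩
    · rcases h1 with h1 | h1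
      · exact Or.inl (Subtype.ext h1)
      · exact Or.inr (Subtype.ext h1)
    · rcases h2 with h2 | h2
      · exact Or.inl (Subtype.ext h2)
      · exact Or.inr (Subtype.ext h2)
  · rintro ⟨d, hd⟩ ⟨d', hd'⟩ hdd
    have := congrArg Subtype.val hdd
    simp only [Prod.mk.injEq] at this
    exact Subtype.ext (DirEdge.ext (hd.trans hd'.symm) this.1 this.2)

instance (e : Edge Λ) : Fintype (DirEdge.Over e) := Fintype.ofFinite _

/-- The list `l` of directed edges is a walk from `a` to `b`. -/
def IsWalk : Vert Λ → List (DirEdge Λ) → Vert Λ → Prop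
  | a, [], b => a = b
  | a, d :: l, b => a = d.src ∧ IsWalk d.tgt l b

/-- The finite directed walks with target `b` (including the one of length zero), each given by
its source and its list of edges. -/
def Walk (b : Vert Λ) : Type (max u v) :=
  {p : Vert Λ × List (DirEdge Λ) // IsWalk p.1 p.2 b}

/-- The source of a walk. -/
def Walk.src {b : Vert Λ} (w : Walk b) : Vert Λ := w.1.1

/-- The walk of length zero at `b`. -/
def Walk.nil (b : Vert Λ) : Walk b := ⟨(b, []), rfl⟩

open Classical in
/-- Removes the first edge of a walk if this is `d`, and is undefined otherwise. -/
def Walk.strip (d : DirEdge Λ) {b : Vert Λ} : Walk b → Option (Walk b)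
  | ⟨(_, []), _⟩ => none
  | ⟨(_, d' :: l), h⟩ => if d' = d then some ⟨(d'.tgt, l), h.2⟩ else none

lemma Walk.strip_inj (d : DirEdge Λ) {b : Vert Λ} (w w' k : Walk b)
    (h : Walk.strip d w = some k) (h' : Walk.strip d w' = some k) : w = w' := by
  obtain ⟨⟨a, _ | ⟨d₁, l⟩⟩, hw⟩ := w
  · simp [Walk.strip] at h
  obtain ⟨⟨a', _ | ⟨d₂, l'⟩⟩, hw'⟩ := w'
  · simp [Walk.strip] at h'
  simp only [Walk.strip, Option.ite_none_right_eq_some] at h h'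
  obtain ⟨rfl, h⟩ := h
  obtain ⟨rfl, h'⟩ := h'
  have := congrArg (fun k : Walk b => k.1.2) (Option.some.inj (h.trans h'.symm))
  simp only at this
  have e1 : a = d₂.src := hw.1
  have e2 : a' = d₂.src := hw'.1
  subst e1 e2 this
  rfl

variable (Λ) in
/-- The Fock space of the Cuntz-Krieger bimodule of the directed graph of `Λ`, as a Hilbert
`C₀(V)`-module. An elementary tensor `ε₁ ⊗ ⋯ ⊗ εₙ` of directed edges is zero unless it is a walk
`w`, and `⟪w, w'⟫ = δ_{w,w'} p_{t(w)}` for walks; vertices `p_a` are the walks of length zero.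
The completion of the finitely supported functions of walks for this inner product consists of
the `C₀`-sections of the Hilbert spaces `ℓ²(walks with target b)`. -/
abbrev Fock : Type (max u v) := C0Sections fun b : Vert Λ => lp (fun _ : Walk b => ℂ) 2

variable (Λ) in
/-- The C*-algebra of adjointable operators on the Fock space. -/
abbrev FockOp : Type (max u v) := Adjointable C₀(Vert Λ, ℂ) (Fock Λ)

/-- The creation operator `L₊(d)`: it maps a walk `w` to `d ⊗ w` if `w` starts at the target of
`d`, and to zero otherwise. -/
def creation (d : DirEdge Λ) : FockOp Λ :=
  fibrewiseAdj (fun _ => partialComp (Walk.strip d) (Walk.strip_inj d) (fun _ => 1) 1 zero_le_one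
    (by simp)) 1 fun _ => norm_partialComp_le _ _ _ _ _ _

/-- The left multiplication by `a ∈ C₀(V)`: a walk `w` is mapped to `a (source of w) • w`. -/
def leftOp (a : C₀(Vert Λ, ℂ)) : FockOp Λ :=
  fibrewiseAdj (fun _ => partialComp some (by grind) (fun w => a w.src) ‖a‖
    (norm_nonneg _) (fun w => norm_apply_le a _)) ‖a‖ fun _ => norm_partialComp_le _ _ _ _ _ _

lemma leftOp_apply (a : C₀(Vert Λ, ℂ)) (ξ : Fock Λ) (b : Vert Λ) (w : Walk b) :
    ((leftOp a).1 ξ).1 b w = a w.src * ξ.1 b w := rfl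

lemma FockOp.ext {S T : FockOp Λ} (h : ∀ ξ b w, (S.1 ξ).1 b w = (T.1 ξ).1 b w) : S = T :=
  Subtype.ext (ContinuousLinearMap.ext fun ξ => C0Sections.ext fun b => lp.ext (funext (h ξ b)))

/-- The left action of `C₀(V)` on the Fock space. -/
def leftAction : C₀(Vert Λ, ℂ) →⋆ₙₐ[ℂ] FockOp Λ where
  toFun := leftOp
  map_smul' c a := FockOp.ext fun ξ b w => mul_assoc c (a w.src) (ξ.1 b w)
  map_zero' := FockOp.ext fun ξ b w => zero_mul (ξ.1 b w)
  map_add' a a' := FockOp.ext fun ξ b w => add_mul (a w.src) (a' w.src) (ξ.1 b w)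
  map_mul' a a' := FockOp.ext fun ξ b w => mul_assoc (a w.src) (a' w.src) (ξ.1 b w)
  map_star' a := by
    symm
    refine star_eq_of_inner fun ξ η => ?_
    ext b
    change ⟪((leftOp a).1 ξ).1 b, η.1 b⟫_ℂ = ⟪ξ.1 b, ((leftOp (star a)).1 η).1 b⟫_ℂ
    rw [lp.inner_eq_tsum, lp.inner_eq_tsum]
    refine tsum_congr fun w => ?_
    rw [leftOp_apply, leftOp_apply]
    simp only [RCLike.inner_apply, map_mul]
    change _ = (starRingEnd ℂ (a w.src) * _) * _
    ring

/-- The inclusion of `C₀(V)` as the summand of degree zero of the Fock space. -/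
def vacuum (c : C₀(Vert Λ, ℂ)) : Fock Λ :=
  open Classical in
  C0Sections.mk (fun b => c b • lp.single 2 (Walk.nil b) (1 : ℂ)) (by
    simpa [norm_smul, lp.norm_single] using (tendsto_cofinite c).norm)

/-- The indicator function `p_a` of the vertex `a`. -/
def proj (a : Vert Λ) : C₀(Vert Λ, ℂ) :=
  letI := Classical.decEq (Vert Λ)
  mkC0 (Pi.single a 1) (tendsto_nhds_of_eventually_eq (by
    rw [Filter.eventually_cofinite]
    refine (Set.finite_singleton a).subset fun x hx => ?_
    by_contra h
    exact hx (Pi.single_eq_of_ne h 1)))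

/-! ### The free graph algebra -/

/-- The operator `T_e`, the sum over the directed edges `d` of `e` of
`(μ(s(d)) / μ(t(d)))^(1/4) (L₊(d) + L₊(d)⋆)`. For a loop this is `L₊(e) + L₊(e)⋆`. For an edge
which is not a loop, with directed edges `e'` and `e''`, the factor of `e'` is
`a = (μ(s(e')) / μ(t(e')))^(1/4)` and that of `e''` is `a⁻¹`. -/
def edgeOp (μ : Vert Λ → ℝ) (e : Edge Λ) : FockOp Λ :=
  ∑ d : DirEdge.Over e, (((μ d.1.src / μ d.1.tgt) ^ (1 / 4 : ℝ) : ℝ) : ℂ) •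
    (creation d.1 + star (creation d.1))

/-- The free graph algebra `S(Λ, μ)`: the C*-subalgebra generated by `C₀(V)` and all `T_e`. It
lies in the Toeplitz-Cuntz-Krieger algebra, generated by `C₀(V)` and all `L₊(d)`. -/
def freeGraphAlgebra (Λ : Graph α β) (μ : Vert Λ → ℝ) : NonUnitalStarSubalgebra ℂ (FockOp Λ) :=
  (NonUnitalStarAlgebra.adjoin ℂ
    (Set.range (leftAction (Λ := Λ)) ∪ Set.range (edgeOp μ))).topologicalClosure

/-- The C*-algebra `S_e` generated by `C₀(V)` and `T_e`. -/
def edgeAlgebra (μ : Vert Λ → ℝ) (e : Edge Λ) : NonUnitalStarSubalgebra ℂ (FockOp Λ) :=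
  (NonUnitalStarAlgebra.adjoin ℂ
    (Set.range (leftAction (Λ := Λ)) ∪ {edgeOp μ e})).topologicalClosure

/-- The term `⟪p_a, x p_a⟫` of the sum which defines `E(x)`. -/
def expectationTerm (x : FockOp Λ) (a : Vert Λ) : C₀(Vert Λ, ℂ) :=
  ⟪vacuum (proj a), x.1 (vacuum (proj a))⟫_(C₀(Vert Λ, ℂ))

/-- The map `E(x) = ∑ₐ ⟪p_a, x p_a⟫`. -/
def expectation (x : FockOp Λ) : C₀(Vert Λ, ℂ) := ∑' a, expectationTerm x a

end Graph

end FreeGraph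
end

noncomputable section

namespace FreeGraph

universe u v

set_option linter.unusedSectionVars false

/-! ### Adjointable operators act fibrewise -/

section Fibers

variable {X : Type u} [TopologicalSpace X] [DiscreteTopology X]
variable {H : X → Type v} [∀ x, NormedAddCommGroup (H x)] [∀ x, InnerProductSpace ℂ (H x)]

/-! An adjointable operator on a module of sections acts fibre by fibre, so everything takes place
on the Hilbert spaces ℓ²(walks ending at `b`). There `E(x)` at `a` is the vacuum coefficient of `x
δ_a`, where `δ_a` is the walk of length zero. Since `‖x δ_a‖` vanishes at infinity for the
generators, and hence for all `x` in the algebra (`mem_decaying`), the sum defining `E` is the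
unconditionally convergent expansion of a function in `C₀(V)`.

Faithfulness rests on a commutation relation. Besides the operators acting at the beginning of a
walk there are operators `rightOp μ d` acting at its end. With suitable weights they intertwine the
action of the whole algebra on the fibres at the two ends of `d` (`edgeOp_rightOp`). If `E(x⋆x) =
0`, then `x` kills all vacuum vectors. As `rightOp μ d` sends `δ_u` to a nonzero multiple of
`δ_{ud}` plus a multiple of a shorter walk, or zero, induction on the length shows that `x` kills
every walk.

Freeness is a statement about supports. If a walk `v` does not begin over `e`, then `S_e` treats it
as a passive tail: `x δ_v` is `x δ_a` with `v` attached, where `a` is the source of `v`. Moreover `x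
δ_a` only involves walks over `e`, and `E(x) = 0` removes the vacuum term, so `x δ_v` lives on walks
beginning over `e` (`fiberHom_apply_eq_zero`). Hence an alternating centred product applied to the
vacuum lives on walks beginning over the edge of its first factor, and has no vacuum component.

For the free product the Fock space itself is the model: `x₁ ⊗ ⋯ ⊗ xₙ b` becomes `x₁ ⋯ xₙ` applied
to the vacuum vector `b`, and the representation is the inclusion. The same support argument gives
the inner products (`inner_wordVec`). Density (`closure_reducedSpan`) follows by isolating each walk
`δ_{dw}` in `T_e δ_w` with a vertex projection. -/

/-- Evaluation of a section at a point. -/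
def C0Sections.eval (x : X) : C0Sections H →L[ℂ] H x :=
  LinearMap.mkContinuous
    { toFun := fun ξ => ξ.1 x
      map_add' := fun _ _ => rfl
      map_smul' := fun _ _ => rfl } 1
    fun ξ => (C0Sections.norm_apply_le ξ x).trans_eq (one_mul _).symm

lemma C0Sections.eval_apply (x : X) (ξ : C0Sections H) : C0Sections.eval x ξ = ξ.1 x := rfl

open Classical in
/-- The sections supported at a point. -/
def C0Sections.single (x : X) : H x →L[ℂ] C0Sections H :=
  LinearMap.mkContinuous
    { toFun := fun ξ => C0Sections.mk (Pi.single x ξ) (tendsto_nhds_of_eventually_eq (by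
        rw [Filter.eventually_cofinite]
        refine (Set.finite_singleton x).subset fun y hy => ?_
        by_contra h
        exact hy (by rw [Pi.single_eq_of_ne h, norm_zero])))
      map_add' := fun ξ η => C0Sections.ext fun y => congrFun (Pi.single_add x ξ η) y
      map_smul' := fun c ξ => C0Sections.ext fun y => congrFun (Pi.single_smul x c ξ) y } 1
    fun ξ => C0Sections.norm_le _ (by positivity) fun y => by
      change ‖(Pi.single x ξ : ∀ y, H y) y‖ ≤ _
      by_cases h : y = x
      · subst h; simp
      · simp [Pi.single_eq_of_ne h]

lemma C0Sections.single_apply_same (x : X) (ξ : H x) : (C0Sections.single x ξ).1 x = ξ := by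
  classical
  exact Pi.single_eq_same x ξ

lemma C0Sections.single_apply_ne {x y : X} (h : y ≠ x) (ξ : H x) :
    (C0Sections.single x ξ).1 y = 0 := by
  classical
  exact Pi.single_eq_of_ne h ξ

lemma C0Sections.inner_apply (ξ η : C0Sections H) (x : X) :
    (⟪ξ, η⟫_(C₀(X, ℂ)) : C₀(X, ℂ)) x = ⟪ξ.1 x, η.1 x⟫_ℂ := rfl

/-- A section is the sum of its values. -/
lemma C0Sections.hasSum_single (ξ : C0Sections H) :
    HasSum (fun x => C0Sections.single x (ξ.1 x)) ξ := by
  classical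
  rw [HasSum, SummationFilter.unconditional_filter, Metric.tendsto_nhds]
  intro ε hε
  have h := ξ.2
  have h' : ∀ᶠ x in Filter.cofinite, ‖ξ.1 x‖ < ε / 2 := by
    have := (Metric.tendsto_nhds.1 h) (ε / 2) (half_pos hε)
    filter_upwards [this] with x hx
    simpa using hx
  rw [Filter.eventually_cofinite] at h'
  filter_upwards [Filter.eventually_ge_atTop h'.toFinset] with s hs
  rw [dist_eq_norm]
  refine (C0Sections.norm_le _ (half_pos hε).le fun x => ?_).trans_lt (half_lt_self hε)
  rw [← C0Sections.eval_apply, map_sub, map_sum]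
  simp only [C0Sections.eval_apply]
  by_cases hx : x ∈ s
  · rw [Finset.sum_eq_single x (fun y _ hy => C0Sections.single_apply_ne hy.symm _)
      (fun h => absurd hx h), C0Sections.single_apply_same, sub_self, norm_zero]
    exact (half_pos hε).le
  · rw [Finset.sum_eq_zero fun y hy => C0Sections.single_apply_ne (by rintro rfl; exact hx hy) _,
      zero_sub, norm_neg]
    by_contra hlt
    exact hx (hs (by simpa using (not_le.1 hlt).le))

variable [∀ x, CompleteSpace (H x)]

/-- The operator on the fibre at `x` given by an adjointable operator. -/
def fiberOp (x : X) (T : Adjointable C₀(X, ℂ) (C0Sections H)) : H x →L[ℂ] H x :=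
  C0Sections.eval x ∘L T.1 ∘L C0Sections.single x

/-- Paired with a section supported at `x`, the value of `T ξ` at `x` can be moved to `star T` and
then sees only `ξ` at `x`. Thus locality comes from the existence of an adjoint, and linearity over
`C₀(X)` need not be shown separately. -/
lemma fiberOp_star_adjoint_apply (x : X) (T : Adjointable C₀(X, ℂ) (C0Sections H))
    (ξ : C0Sections H) : (T.1 ξ).1 x = (fiberOp x (star T)).adjoint (ξ.1 x) := by
  refine ext_inner_left ℂ fun η => ?_
  rw [ContinuousLinearMap.adjoint_inner_right]
  have h := congrArg (fun f : C₀(X, ℂ) => f x) (inner_apply_right T (C0Sections.single x η) ξ)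
  rwa [C0Sections.inner_apply, C0Sections.inner_apply, C0Sections.single_apply_same] at h

lemma fiberOp_star (x : X) (T : Adjointable C₀(X, ℂ) (C0Sections H)) :
    fiberOp x (star T) = (fiberOp x T).adjoint := by
  rw [← ContinuousLinearMap.adjoint_adjoint (fiberOp x (star T))]
  congr 1
  refine ContinuousLinearMap.ext fun ξ => ?_
  have := fiberOp_star_adjoint_apply x T (C0Sections.single x ξ)
  rw [C0Sections.single_apply_same] at this
  exact this.symm

lemma apply_eq_fiberOp (x : X) (T : Adjointable C₀(X, ℂ) (C0Sections H))
    (ξ : C0Sections H) : (T.1 ξ).1 x = fiberOp x T (ξ.1 x) := by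
  rw [fiberOp_star_adjoint_apply, fiberOp_star, ContinuousLinearMap.adjoint_adjoint]

/-- The restriction of adjointable operators to the fibre at `x`. -/
def fiberHom (x : X) :
    Adjointable C₀(X, ℂ) (C0Sections H) →⋆ₐ[ℂ] (H x →L[ℂ] H x) where
  toFun := fiberOp x
  map_one' := ContinuousLinearMap.ext fun ξ => C0Sections.single_apply_same x ξ
  map_mul' S T := ContinuousLinearMap.ext fun ξ => by
    change (S.1 (T.1 (C0Sections.single x ξ))).1 x = fiberOp x S (fiberOp x T ξ)
    rw [apply_eq_fiberOp, apply_eq_fiberOp, C0Sections.single_apply_same]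
  map_zero' := rfl
  map_add' _ _ := rfl
  commutes' c := ContinuousLinearMap.ext fun ξ => by
    change c • (C0Sections.single x ξ).1 x = c • ξ
    rw [C0Sections.single_apply_same]
  map_star' := fiberOp_star x

lemma apply_eq_fiberHom (x : X) (T : Adjointable C₀(X, ℂ) (C0Sections H))
    (ξ : C0Sections H) : (T.1 ξ).1 x = fiberHom x T (ξ.1 x) := apply_eq_fiberOp x T ξ

lemma continuous_fiberHom (x : X) : Continuous (fiberHom (H := H) x) :=
  (NonUnitalStarAlgHom.norm_apply_le (fiberHom (H := H) x) |> fun h =>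
    AddMonoidHomClass.continuous_of_bound (fiberHom (H := H) x) 1 (by simpa using h))

lemma norm_fiberHom_le (x : X) (T : Adjointable C₀(X, ℂ) (C0Sections H)) :
    ‖fiberHom x T‖ ≤ ‖T‖ := NonUnitalStarAlgHom.norm_apply_le (fiberHom (H := H) x) T

lemma fiberHom_fibrewiseAdj (T : ∀ x, H x →L[ℂ] H x) (C : ℝ) (hT : ∀ x, ‖T x‖ ≤ C) (x : X) :
    fiberHom x (fibrewiseAdj T C hT) = T x := ContinuousLinearMap.ext fun ξ => by
  change T x ((C0Sections.single x ξ).1 x) = T x ξ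
  rw [C0Sections.single_apply_same]

lemma adjointable_ext_fiber {S T : Adjointable C₀(X, ℂ) (C0Sections H)}
    (h : ∀ x, fiberHom x S = fiberHom x T) : S = T :=
  Subtype.ext (ContinuousLinearMap.ext fun ξ => C0Sections.ext fun x => by
    rw [apply_eq_fiberHom, apply_eq_fiberHom, h])

lemma apply_single (x : X) (T : Adjointable C₀(X, ℂ) (C0Sections H)) (ξ : H x) :
    T.1 (C0Sections.single x ξ) = C0Sections.single x (fiberHom x T ξ) :=
  C0Sections.ext fun y => by
    rw [apply_eq_fiberHom]
    by_cases h : y = x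
    · subst h; rw [C0Sections.single_apply_same, C0Sections.single_apply_same]
    · rw [C0Sections.single_apply_ne h, C0Sections.single_apply_ne h, map_zero]

end Fibers

/-! ### The standard basis of `ℓ²` and operators induced by injective maps -/

section Basis

variable {ι κ : Type*}

open Classical in
/-- The standard basis vectors of `ℓ²(ι)`. -/
def basisVec (i : ι) : lp (fun _ : ι => ℂ) 2 := lp.single 2 i (1 : ℂ)

lemma basisVec_self (i : ι) : basisVec i i = 1 := by
  classical
  exact lp.single_apply_self (E := fun _ : ι => ℂ) 2 i (1 : ℂ)

lemma basisVec_ne {i k : ι} (h : k ≠ i) : basisVec i k = 0 := by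
  classical
  exact lp.single_apply_ne (E := fun _ : ι => ℂ) 2 i (1 : ℂ) h

open Classical in
lemma basisVec_apply (i k : ι) : basisVec i k = if k = i then 1 else 0 := by
  split_ifs with h
  · rw [h, basisVec_self]
  · exact basisVec_ne h

lemma inner_basisVec_left (i : ι) (ξ : lp (fun _ : ι => ℂ) 2) : ⟪basisVec i, ξ⟫_ℂ = ξ i := by
  classical
  rw [basisVec, lp.inner_single_left]
  simp

lemma norm_basisVec (i : ι) : ‖(basisVec i : lp (fun _ : ι => ℂ) 2)‖ = 1 := by
  classical
  rw [basisVec, lp.norm_single (by simp), norm_one]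

lemma hasSum_basisVec (ξ : lp (fun _ : ι => ℂ) 2) : HasSum (fun i => ξ i • basisVec i) ξ := by
  classical
  convert lp.hasSum_single (by simp) ξ using 2 with i
  rw [basisVec, ← lp.single_smul, smul_eq_mul, mul_one]

lemma clm_ext_basisVec {F : Type*} [NormedAddCommGroup F] [NormedSpace ℂ F]
    {S T : lp (fun _ : ι => ℂ) 2 →L[ℂ] F} (h : ∀ i, S (basisVec i) = T (basisVec i)) : S = T := by
  refine ContinuousLinearMap.ext fun ξ => ?_
  have hS := (hasSum_basisVec ξ).mapL S
  have hT := (hasSum_basisVec ξ).mapL T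
  refine hS.unique ?_
  convert hT using 2 with i
  rw [map_smul, map_smul, h]

lemma orthonormal_basisVec : Orthonormal ℂ (basisVec : ι → lp (fun _ : ι => ℂ) 2) := by
  classical
  rw [orthonormal_iff_ite]
  intro i k
  rw [inner_basisVec_left, basisVec_apply]

/-- The isometry `δ_i ↦ δ_{φ i}` of `ℓ²(ι)` into `ℓ²(κ)` for an injective map `φ`. -/
def pushIsometry (φ : ι → κ) (hφ : Function.Injective φ) :
    lp (fun _ : ι => ℂ) 2 →L[ℂ] lp (fun _ : κ => ℂ) 2 :=
  ((orthonormal_basisVec.comp φ hφ).orthogonalFamily.linearIsometry).toContinuousLinearMap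

lemma pushIsometry_basisVec (φ : ι → κ) (hφ : Function.Injective φ) (i : ι) :
    pushIsometry φ hφ (basisVec i) = basisVec (φ i) := by
  classical
  have := (orthonormal_basisVec.comp φ hφ).orthogonalFamily.linearIsometry_apply_single
    (i := i) (1 : ℂ)
  refine this.trans ?_
  simp [LinearIsometry.toSpanSingleton]

lemma pushIsometry_adjoint_apply (φ : ι → κ) (hφ : Function.Injective φ)
    (ξ : lp (fun _ : κ => ℂ) 2) (i : ι) : (pushIsometry φ hφ).adjoint ξ i = ξ (φ i) := by
  rw [← inner_basisVec_left, ContinuousLinearMap.adjoint_inner_right, pushIsometry_basisVec,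
    inner_basisVec_left]

lemma pushIsometry_apply_of_notMem (φ : ι → κ) (hφ : Function.Injective φ)
    (ξ : lp (fun _ : ι => ℂ) 2) (k : κ) (hk : ∀ i, φ i ≠ k) : pushIsometry φ hφ ξ k = 0 := by
  have h := ((hasSum_basisVec ξ).mapL (pushIsometry φ hφ)).mapL (innerSL ℂ (basisVec k))
  have h0 : ∀ i, innerSL ℂ (basisVec k) (pushIsometry φ hφ (ξ i • basisVec i)) = 0 := fun i => by
    rw [map_smul, map_smul, pushIsometry_basisVec, innerSL_apply_apply, inner_basisVec_left,
      basisVec_ne (hk i).symm, smul_zero]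
  simp only [h0] at h
  rw [← inner_basisVec_left]
  exact h.unique hasSum_zero

lemma pushIsometry_apply_self (φ : ι → κ) (hφ : Function.Injective φ)
    (ξ : lp (fun _ : ι => ℂ) 2) (i : ι) : pushIsometry φ hφ ξ (φ i) = ξ i := by
  rw [← inner_basisVec_left, ← inner_basisVec_left, ← pushIsometry_basisVec φ hφ]
  exact LinearIsometry.inner_map_map _ _ _

lemma pushIsometry_adjoint_basisVec (φ : ι → κ) (hφ : Function.Injective φ)
    (i : ι) : (pushIsometry φ hφ).adjoint (basisVec (φ i)) = basisVec i := by
  refine lp.ext (funext fun k => ?_)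
  rw [pushIsometry_adjoint_apply]
  by_cases h : k = i
  · rw [h, basisVec_self, basisVec_self]
  · rw [basisVec_ne h, basisVec_ne fun h' => h (hφ h')]

lemma pushIsometry_adjoint_basisVec_of_notMem (φ : ι → κ)
    (hφ : Function.Injective φ) (k : κ) (hk : ∀ i, φ i ≠ k) :
    (pushIsometry φ hφ).adjoint (basisVec k) = 0 := by
  refine lp.ext (funext fun i => ?_)
  rw [pushIsometry_adjoint_apply, basisVec_ne (hk i)]
  rfl

end Basis

/-! ### Walks, creation operators on the fibres, and edge weights -/

section Walks

variable {α : Type u} {β : Type v} {Λ : Graph α β} {b : Vert Λ}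

/-- The directed edge with the opposite direction. -/
def DirEdge.op (d : DirEdge Λ) : DirEdge Λ := ⟨d.edge, d.tgt, d.src, d.isLink.symm⟩

lemma DirEdge.src_op (d : DirEdge Λ) : d.op.src = d.tgt := rfl

lemma DirEdge.tgt_op (d : DirEdge Λ) : d.op.tgt = d.src := rfl

lemma Walk.ext {w w' : Walk b} (h : w.src = w'.src) (h' : w.1.2 = w'.1.2) : w = w' :=
  Subtype.ext (Prod.ext h h')

/-- Adds an edge at the beginning of a walk. -/
def Walk.cons (d : DirEdge Λ) (w : Walk b) (h : d.tgt = w.src) : Walk b :=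
  ⟨(d.src, d :: w.1.2), rfl, h ▸ w.2⟩

/-- The walk of length one given by a directed edge. -/
def Walk.single (d : DirEdge Λ) (h : d.tgt = b) : Walk b := ⟨(d.src, [d]), rfl, h⟩

lemma Walk.src_single (d : DirEdge Λ) (h : d.tgt = b) : (Walk.single d h).src = d.src := rfl

lemma IsWalk.append {a c b : Vert Λ} {l l' : List (DirEdge Λ)} (h : IsWalk a l c)
    (h' : IsWalk c l' b) : IsWalk a (l ++ l') b := by
  induction l generalizing a with
  | nil => cases (show a = c from h); exact h'
  | cons d l ih => exact ⟨h.1, ih h.2⟩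

/-- The concatenation of walks. -/
def Walk.append {a : Vert Λ} (v : Walk b) (h : v.src = a) (u : Walk a) : Walk b :=
  -- The argument `u` is traversed first and `v` is the fixed tail, so operators acting at the
  -- beginning of a walk meet `u` before `v`.
  ⟨(u.src, u.1.2 ++ v.1.2), u.2.append (h ▸ v.2)⟩

lemma Walk.append_injective {a : Vert Λ} (v : Walk b) (h : v.src = a) :
    Function.Injective (v.append h) := fun _ _ hu =>
  Walk.ext (congrArg (fun w : Walk b => w.1.1) hu)
    (List.append_cancel_right (congrArg (fun w : Walk b => w.1.2) hu))

lemma Walk.nil_or_cons (w : Walk b) :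
    w = Walk.nil b ∨ ∃ (d : DirEdge Λ) (w' : Walk b) (h : d.tgt = w'.src), w = w'.cons d h := by
  obtain ⟨⟨a, _ | ⟨d, l⟩⟩, h⟩ := w
  · exact Or.inl (Walk.ext h rfl)
  · exact Or.inr ⟨d, ⟨(d.tgt, l), h.2⟩, rfl, Walk.ext h.1 rfl⟩

lemma Walk.append_nil {a : Vert Λ} (v : Walk b) (h : v.src = a) :
    v.append h (Walk.nil a) = v := Walk.ext h.symm rfl

lemma Walk.src_append {a : Vert Λ} (v : Walk b) (h : v.src = a) (u : Walk a) :
    (v.append h u).src = u.src := rfl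

lemma Walk.append_cons {a : Vert Λ} (v : Walk b) (h : v.src = a) (d : DirEdge Λ) (u : Walk a)
    (hd : d.tgt = u.src) :
    v.append h (u.cons d hd) = (v.append h u).cons d (hd.trans (v.src_append h u).symm) := rfl

lemma Walk.strip_nil (d : DirEdge Λ) : Walk.strip d (Walk.nil b) = none := rfl

lemma Walk.strip_cons_self (d : DirEdge Λ) (w : Walk b) (h : d.tgt = w.src) :
    Walk.strip d (w.cons d h) = some w := by
  simp only [Walk.strip, Walk.cons, if_true]
  exact congrArg some (Walk.ext h rfl)

lemma Walk.strip_cons_of_ne {d f : DirEdge Λ} (hf : f ≠ d) (w : Walk b) (h : d.tgt = w.src) :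
    Walk.strip f (w.cons d h) = none := by
  simp only [Walk.strip, Walk.cons, if_neg hf.symm]

lemma Walk.cons_ne_nil (d : DirEdge Λ) (w : Walk b) (h : d.tgt = w.src) :
    w.cons d h ≠ Walk.nil b := fun h' =>
  List.cons_ne_nil _ _ (congrArg (fun w : Walk b => w.1.2) h')

/-- The creation operator on the walks with target `b`. -/
def create (b : Vert Λ) (d : DirEdge Λ) :
    lp (fun _ : Walk b => ℂ) 2 →L[ℂ] lp (fun _ : Walk b => ℂ) 2 :=
  fiberHom b (creation d)

lemma create_apply (d : DirEdge Λ) (ξ : lp (fun _ : Walk b => ℂ) 2) (w : Walk b) :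
    create b d ξ w = (Walk.strip d w).elim 0 ξ := by
  rw [create, creation, fiberHom_fibrewiseAdj, partialComp_apply, one_mul]

lemma create_basisVec (d : DirEdge Λ) (w : Walk b) (h : d.tgt = w.src) :
    create b d (basisVec w) = basisVec (w.cons d h) := by
  refine lp.ext (funext fun k => ?_)
  rw [create_apply]
  cases hk : Walk.strip d k with
  | none =>
    rw [basisVec_ne]
    · rfl
    · rintro rfl
      rw [Walk.strip_cons_self] at hk
      cases hk
  | some w' =>
    change basisVec w w' = _
    by_cases hw : w' = w
    · subst hw
      rw [basisVec_self, Walk.strip_inj d k (w'.cons d h) w' hk (Walk.strip_cons_self _ _ _),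
        basisVec_self]
    · rw [basisVec_ne hw, basisVec_ne]
      rintro rfl
      rw [Walk.strip_cons_self] at hk
      exact hw (Option.some.inj hk).symm

lemma create_basisVec_of_ne (d : DirEdge Λ) (w : Walk b) (h : d.tgt ≠ w.src) :
    create b d (basisVec w) = 0 := by
  refine lp.ext (funext fun k => ?_)
  rw [create_apply]
  cases hk : Walk.strip d k with
  | none => rfl
  | some w' =>
    change basisVec w w' = 0
    rw [basisVec_ne]
    rintro rfl
    obtain rfl | ⟨f, k, hf, rfl⟩ := k.nil_or_cons
    · cases hk
    · by_cases hfd : d = f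
      · subst hfd
        rw [Walk.strip_cons_self] at hk
        cases hk
        exact h hf
      · rw [Walk.strip_cons_of_ne hfd] at hk
        cases hk

lemma create_adjoint_apply (d : DirEdge Λ) (ξ : lp (fun _ : Walk b => ℂ) 2) (w : Walk b)
    (h : d.tgt = w.src) : (create b d).adjoint ξ w = ξ (w.cons d h) := by
  rw [← inner_basisVec_left, ContinuousLinearMap.adjoint_inner_right, create_basisVec d w h,
    inner_basisVec_left]

lemma create_adjoint_apply_of_ne (d : DirEdge Λ) (ξ : lp (fun _ : Walk b => ℂ) 2) (w : Walk b)
    (h : d.tgt ≠ w.src) : (create b d).adjoint ξ w = 0 := by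
  rw [← inner_basisVec_left, ContinuousLinearMap.adjoint_inner_right,
    create_basisVec_of_ne d w h, inner_zero_left]

lemma create_adjoint_basisVec_cons (d : DirEdge Λ) (w : Walk b) (h : d.tgt = w.src) :
    (create b d).adjoint (basisVec (w.cons d h)) = basisVec w := by
  refine lp.ext (funext fun k => ?_)
  by_cases hk : d.tgt = k.src
  · rw [create_adjoint_apply d _ k hk]
    by_cases hkw : k = w
    · subst hkw; rw [basisVec_self, basisVec_self]
    · rw [basisVec_ne hkw, basisVec_ne]
      intro h'
      have := congrArg (Walk.strip d) h'
      rw [Walk.strip_cons_self, Walk.strip_cons_self] at this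
      exact hkw (Option.some.inj this)
  · rw [create_adjoint_apply_of_ne d _ k hk, basisVec_ne]
    rintro rfl
    exact hk h

lemma create_adjoint_basisVec_of_none (d : DirEdge Λ) (w : Walk b)
    (h : Walk.strip d w = none) : (create b d).adjoint (basisVec w) = 0 := by
  refine lp.ext (funext fun k => ?_)
  by_cases hk : d.tgt = k.src
  · rw [create_adjoint_apply d _ k hk, basisVec_ne]
    · rfl
    · rintro rfl
      rw [Walk.strip_cons_self] at h
      cases h
  · rw [create_adjoint_apply_of_ne d _ k hk]
    rfl

lemma star_leftAction (c : C₀(Vert Λ, ℂ)) :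
    star (leftAction (Λ := Λ) c) = leftAction (star c) := (leftAction.map_star' c).symm

lemma fiberHom_leftAction_apply (a : C₀(Vert Λ, ℂ)) (ξ : lp (fun _ : Walk b => ℂ) 2)
    (w : Walk b) : fiberHom b (leftAction a) ξ w = a w.src * ξ w := by
  change fiberHom b (leftOp a) ξ w = _
  rw [leftOp, fiberHom_fibrewiseAdj]
  rfl

lemma fiberHom_leftAction_basisVec (a : C₀(Vert Λ, ℂ)) (w : Walk b) :
    fiberHom b (leftAction a) (basisVec w) = a w.src • basisVec w := by
  refine lp.ext (funext fun k => ?_)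
  rw [fiberHom_leftAction_apply]
  change _ = a w.src * basisVec w k
  by_cases h : k = w
  · rw [h]
  · rw [basisVec_ne h, mul_zero, mul_zero]

/-- The coefficient of a directed edge in the operator of its edge. -/
def weight (μ : Vert Λ → ℝ) (d : DirEdge Λ) : ℂ := (((μ d.src / μ d.tgt) ^ (1 / 4 : ℝ) : ℝ) : ℂ)

/-- The two ratios are reciprocal. This serves to show that weights do not vanish; the commutation
relation below holds without it. -/
lemma weight_mul_weight_op {μ : Vert Λ → ℝ} (hμ : ∀ a, 0 < μ a) (d : DirEdge Λ) :
    weight μ d * weight μ d.op = 1 := by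
  have h1 := hμ d.src
  have h2 := hμ d.tgt
  rw [weight, weight, ← Complex.ofReal_mul, DirEdge.op, ← Real.mul_rpow (by positivity)
    (by positivity), div_mul_div_comm, mul_comm (μ d.tgt), div_self (by positivity),
    Real.one_rpow, Complex.ofReal_one]

lemma weight_ne_zero {μ : Vert Λ → ℝ} (hμ : ∀ a, 0 < μ a) (d : DirEdge Λ) : weight μ d ≠ 0 :=
  left_ne_zero_of_mul (weight_mul_weight_op hμ d ▸ one_ne_zero)

lemma fiberHom_star (b : Vert Λ) (x : FockOp Λ) :
    fiberHom b (star x) = (fiberHom b x).adjoint := map_star _ x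

/-- The operator `L₊(d) + L₊(d)⋆` on the walks with target `b`. -/
def fieldOp (b : Vert Λ) (d : DirEdge Λ) :
    lp (fun _ : Walk b => ℂ) 2 →L[ℂ] lp (fun _ : Walk b => ℂ) 2 :=
  create b d + (create b d).adjoint

/-- The underlying directed edge. -/
def DirEdge.Over.dir {e : Edge Λ} (f : DirEdge.Over e) : DirEdge Λ := f.1

lemma DirEdge.Over.edge_dir {e : Edge Λ} (f : DirEdge.Over e) : f.dir.edge = e := f.2

lemma DirEdge.Over.ext {e : Edge Λ} {f f' : DirEdge.Over e} (h : f.dir = f'.dir) : f = f' :=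
  Subtype.ext h

/-- A directed edge as an edge over its undirected edge. -/
def DirEdge.toOver {e : Edge Λ} (d : DirEdge Λ) (h : d.edge = e) : DirEdge.Over e := ⟨d, h⟩

lemma DirEdge.dir_toOver {e : Edge Λ} (d : DirEdge Λ) (h : d.edge = e) :
    (d.toOver h).dir = d := rfl

lemma fiberHom_edgeOp (b : Vert Λ) (μ : Vert Λ → ℝ) (e : Edge Λ) : fiberHom b (edgeOp μ e) =
    ∑ d : DirEdge.Over e, weight μ d.dir • fieldOp b d.dir := by
  rw [edgeOp, map_sum]
  refine Finset.sum_congr rfl fun d _ => ?_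
  rw [map_smul, map_add, fiberHom_star]
  rfl

lemma star_edgeOp (μ : Vert Λ → ℝ) (e : Edge Λ) : star (edgeOp μ e) = edgeOp μ e := by
  rw [edgeOp, star_sum]
  refine Finset.sum_congr rfl fun d _ => ?_
  rw [star_smul, star_add, star_star, add_comm, Complex.star_def, Complex.conj_ofReal]

/-! ### Concatenation with a fixed walk -/

section Append

variable {a : Vert Λ} (v : Walk b) (hv : v.src = a)

/-- The isometry `δ_u ↦ δ_{u v}`. -/
def appendOp : lp (fun _ : Walk a => ℂ) 2 →L[ℂ] lp (fun _ : Walk b => ℂ) 2 :=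
  pushIsometry (v.append hv) (v.append_injective hv)

lemma appendOp_basisVec (u : Walk a) :
    appendOp v hv (basisVec u) = basisVec (v.append hv u) := pushIsometry_basisVec _ _ u

/-- Left multiplication depends only on the source of a walk, which a tail does not change. -/
lemma leftAction_appendOp (c : C₀(Vert Λ, ℂ)) :
    fiberHom b (leftAction c) ∘L appendOp v hv = appendOp v hv ∘L fiberHom a (leftAction c) :=
  clm_ext_basisVec fun u => by
    rw [ContinuousLinearMap.comp_apply, ContinuousLinearMap.comp_apply, appendOp_basisVec,
      fiberHom_leftAction_basisVec, fiberHom_leftAction_basisVec, map_smul, appendOp_basisVec,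
      Walk.src_append]

lemma create_appendOp (f : DirEdge Λ) :
    create b f ∘L appendOp v hv = appendOp v hv ∘L create a f :=
  clm_ext_basisVec fun u => by
    rw [ContinuousLinearMap.comp_apply, ContinuousLinearMap.comp_apply, appendOp_basisVec]
    by_cases h : f.tgt = u.src
    · rw [create_basisVec f u h, create_basisVec f (v.append hv u) h, appendOp_basisVec,
        Walk.append_cons]
    · rw [create_basisVec_of_ne f u h, create_basisVec_of_ne f (v.append hv u) h, map_zero]

/-- As long as an edge precedes the tail, annihilation acts on that edge and never reaches `v`, so
no condition on `v` is needed. The empty walk, where the tail is exposed, is treated separately in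
each application. -/
lemma create_adjoint_appendOp_cons (f d : DirEdge Λ) (u : Walk a) (h : d.tgt = u.src) :
    (create b f).adjoint (appendOp v hv (basisVec (u.cons d h))) =
      appendOp v hv ((create a f).adjoint (basisVec (u.cons d h))) := by
  rw [appendOp_basisVec, Walk.append_cons]
  by_cases hfd : f = d
  · subst hfd
    rw [create_adjoint_basisVec_cons, create_adjoint_basisVec_cons, appendOp_basisVec]
  · rw [create_adjoint_basisVec_of_none _ _ (Walk.strip_cons_of_ne hfd _ _),
      create_adjoint_basisVec_of_none _ _ (Walk.strip_cons_of_ne hfd _ _), map_zero]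

lemma create_adjoint_appendOp (f : DirEdge Λ) (hf : Walk.strip f v = none) :
    (create b f).adjoint ∘L appendOp v hv = appendOp v hv ∘L (create a f).adjoint :=
  clm_ext_basisVec fun u => by
    rw [ContinuousLinearMap.comp_apply, ContinuousLinearMap.comp_apply]
    obtain rfl | ⟨d, u, h, rfl⟩ := u.nil_or_cons
    · rw [appendOp_basisVec, Walk.append_nil, create_adjoint_basisVec_of_none _ _ hf,
        create_adjoint_basisVec_of_none _ _ (Walk.strip_nil f), map_zero]
    · exact create_adjoint_appendOp_cons v hv f d u h

/-- A tail not beginning over `e` is invisible to `T_e`. This is the geometric source of freeness.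
-/
lemma edgeOp_appendOp (μ : Vert Λ → ℝ) (e : Edge Λ)
    (hf : ∀ f : DirEdge Λ, f.edge = e → Walk.strip f v = none) :
    fiberHom b (edgeOp μ e) ∘L appendOp v hv = appendOp v hv ∘L fiberHom a (edgeOp μ e) := by
  rw [fiberHom_edgeOp, fiberHom_edgeOp, ContinuousLinearMap.finsetSum_comp,
    ContinuousLinearMap.comp_finsetSum]
  refine Finset.sum_congr rfl fun f _ => ?_
  rw [ContinuousLinearMap.smul_comp, ContinuousLinearMap.comp_smul, fieldOp, fieldOp,
    ContinuousLinearMap.add_comp, ContinuousLinearMap.comp_add, create_appendOp,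
    create_adjoint_appendOp v hv f.dir (hf f.dir f.edge_dir)]

end Append

/-! ### The right-handed operators which commute with the free graph algebra -/

variable (Λ) in
/-- The partial isometry between the spans of two walks of length zero. -/
def vacuumOp (a b : Vert Λ) : lp (fun _ : Walk a => ℂ) 2 →L[ℂ] lp (fun _ : Walk b => ℂ) 2 :=
  InnerProductSpace.rankOne ℂ (basisVec (Walk.nil b)) (basisVec (Walk.nil a))

lemma vacuumOp_apply (a b : Vert Λ) (ξ : lp (fun _ : Walk a => ℂ) 2) :
    vacuumOp Λ a b ξ = ξ (Walk.nil a) • basisVec (Walk.nil b) := by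
  rw [vacuumOp, InnerProductSpace.rankOne_apply, inner_basisVec_left]

lemma vacuumOp_adjoint (a b : Vert Λ) : (vacuumOp Λ a b).adjoint = vacuumOp Λ b a :=
  InnerProductSpace.adjoint_rankOne _ _

/-- The isometry `δ_u ↦ δ_{u d}` for a directed edge `d` from `a` to `b`. -/
def rightCreate {a b : Vert Λ} (d : DirEdge Λ) (ha : d.src = a) (hb : d.tgt = b) :
    lp (fun _ : Walk a => ℂ) 2 →L[ℂ] lp (fun _ : Walk b => ℂ) 2 :=
  appendOp (Walk.single d hb) ((Walk.src_single d hb).trans ha)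

section Right

variable {a b : Vert Λ} (d : DirEdge Λ) (ha : d.src = a) (hb : d.tgt = b)

lemma rightCreate_basisVec (u : Walk a) :
    rightCreate d ha hb (basisVec u) = basisVec 
      ((Walk.single d hb).append ((Walk.src_single d hb).trans ha) u) :=
  appendOp_basisVec _ _ u

lemma create_rightCreate (f : DirEdge Λ) :
    create b f ∘L rightCreate d ha hb = rightCreate d ha hb ∘L create a f :=
  create_appendOp _ _ f

-- Removing the first edge and adding a last one commute except on the empty walk, where the added
-- edge is also the first one. The defect is the rank-one term.
open Classical in
lemma create_adjoint_rightCreate (f : DirEdge Λ) :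
    (create b f).adjoint ∘L rightCreate d ha hb =
      rightCreate d ha hb ∘L (create a f).adjoint +
        (if f = d then (1 : ℂ) else 0) • vacuumOp Λ a b := by
  split_ifs with hfd
  · subst hfd
    refine clm_ext_basisVec fun u => ?_
    rw [add_apply, ContinuousLinearMap.comp_apply, one_smul,
      ContinuousLinearMap.comp_apply, vacuumOp_apply]
    obtain rfl | ⟨d, u, h, rfl⟩ := u.nil_or_cons
    · rw [basisVec_self, one_smul, create_adjoint_basisVec_of_none _ _ (Walk.strip_nil f),
        map_zero, zero_add, rightCreate_basisVec, Walk.append_nil]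
      subst hb
      exact create_adjoint_basisVec_cons f (Walk.nil f.tgt) rfl
    · rw [basisVec_ne (Walk.cons_ne_nil d u h).symm, zero_smul, add_zero]
      exact create_adjoint_appendOp_cons _ _ f d u h
  · rw [zero_smul, add_zero]
    subst hb
    exact create_adjoint_appendOp _ _ f (Walk.strip_cons_of_ne hfd (Walk.nil d.tgt) rfl)

lemma rightCreate_adjoint_create_adjoint (f : DirEdge Λ) :
    (create a f).adjoint ∘L (rightCreate d ha hb).adjoint =
      (rightCreate d ha hb).adjoint ∘L (create b f).adjoint := by
  rw [← ContinuousLinearMap.adjoint_comp, ← create_rightCreate,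
    ContinuousLinearMap.adjoint_comp]

-- This is the adjoint of `create_adjoint_rightCreate`.
open Classical in
lemma create_rightCreate_adjoint (f : DirEdge Λ) :
    (rightCreate d ha hb).adjoint ∘L create b f =
      create a f ∘L (rightCreate d ha hb).adjoint +
        (if f = d then (1 : ℂ) else 0) • vacuumOp Λ b a := by
  have h := congrArg ContinuousLinearMap.adjoint (create_adjoint_rightCreate d ha hb f)
  rw [map_add, ContinuousLinearMap.adjoint_comp, ContinuousLinearMap.adjoint_comp,
    ContinuousLinearMap.adjoint_adjoint, ContinuousLinearMap.adjoint_adjoint] at h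
  rw [h]
  split_ifs
  · rw [one_smul, one_smul, vacuumOp_adjoint]
  · rw [zero_smul, zero_smul, map_zero]

end Right

/-- The right-handed analogue of the compressions of the operator of an edge. -/
def rightOp (μ : Vert Λ → ℝ) (d : DirEdge Λ) :
    lp (fun _ : Walk d.src => ℂ) 2 →L[ℂ] lp (fun _ : Walk d.tgt => ℂ) 2 :=
  -- The weights are crossed: creation of `d` carries the weight of the opposite edge. This makes
  -- the two rank-one defects in `edgeOp_rightOp` cancel.
  weight μ d.op • rightCreate d rfl rfl +
    weight μ d • (rightCreate d.op d.src_op d.tgt_op).adjoint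

lemma comp_rightOp {μ : Vert Λ → ℝ} {d : DirEdge Λ}
    {A : lp (fun _ : Walk d.tgt => ℂ) 2 →L[ℂ] lp (fun _ : Walk d.tgt => ℂ) 2}
    {B : lp (fun _ : Walk d.src => ℂ) 2 →L[ℂ] lp (fun _ : Walk d.src => ℂ) 2}
    (h : A ∘L rightCreate d rfl rfl = rightCreate d rfl rfl ∘L B)
    (h' : A ∘L (rightCreate d.op d.src_op d.tgt_op).adjoint =
      (rightCreate d.op d.src_op d.tgt_op).adjoint ∘L B) :
    A ∘L rightOp μ d = rightOp μ d ∘L B := by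
  simp only [rightOp, ContinuousLinearMap.comp_add, ContinuousLinearMap.add_comp,
    ContinuousLinearMap.comp_smul, ContinuousLinearMap.smul_comp]
  rw [h, h']

lemma leftAction_rightOp (μ : Vert Λ → ℝ) (d : DirEdge Λ) (c : C₀(Vert Λ, ℂ)) :
    fiberHom d.tgt (leftAction c) ∘L rightOp μ d =
      rightOp μ d ∘L fiberHom d.src (leftAction c) := by
  have h1 : fiberHom d.tgt (leftAction c) ∘L rightCreate d rfl rfl =
    rightCreate d rfl rfl ∘L fiberHom d.src (leftAction c) := leftAction_appendOp _ _ c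
  have h2 : fiberHom d.src (leftAction (star c)) ∘L rightCreate d.op d.src_op d.tgt_op =
    rightCreate d.op d.src_op d.tgt_op ∘L fiberHom d.tgt (leftAction (star c)) :=
      leftAction_appendOp _ _ (star c)
  -- The annihilation part is obtained from the creation part for `star c` by taking adjoints.
  have h3 := congrArg ContinuousLinearMap.adjoint h2
  rw [ContinuousLinearMap.adjoint_comp, ContinuousLinearMap.adjoint_comp, ← fiberHom_star,
    ← fiberHom_star, star_leftAction, star_star] at h3
  exact comp_rightOp h1 h3.symm

-- There are two defects, both on the vacuum: `L₊(f)⋆` removes the edge just added on the right, and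
-- right annihilation removes the edge just added by `L₊(f)`. They enter with opposite signs because
-- they arise on opposite sides of the equation.
open Classical in
lemma fieldOp_rightOp (μ : Vert Λ → ℝ) (f d : DirEdge Λ) :
    fieldOp d.tgt f ∘L rightOp μ d = rightOp μ d ∘L fieldOp d.src f +
      ((if f = d then (1 : ℂ) else 0) * weight μ d.op -
        (if f = d.op then (1 : ℂ) else 0) * weight μ d) • vacuumOp Λ d.src d.tgt := by
  have h1 := create_rightCreate d rfl rfl f
  have h2 := create_adjoint_rightCreate d rfl rfl f
  have h3 := rightCreate_adjoint_create_adjoint d.op d.src_op d.tgt_op f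
  have h4 := create_rightCreate_adjoint d.op d.src_op d.tgt_op f
  simp only [rightOp, fieldOp, ContinuousLinearMap.comp_add, ContinuousLinearMap.add_comp,
    ContinuousLinearMap.comp_smul, ContinuousLinearMap.smul_comp]
  rw [h1, h2, h3, h4]
  module

lemma edgeOp_rightOp (μ : Vert Λ → ℝ) (e : Edge Λ) (d : DirEdge Λ) :
    fiberHom d.tgt (edgeOp μ e) ∘L rightOp μ d =
      rightOp μ d ∘L fiberHom d.src (edgeOp μ e) := by
  classical
  rw [fiberHom_edgeOp, fiberHom_edgeOp, ContinuousLinearMap.finsetSum_comp,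
    ContinuousLinearMap.comp_finsetSum]
  simp only [ContinuousLinearMap.smul_comp, ContinuousLinearMap.comp_smul, fieldOp_rightOp,
    smul_add, smul_smul]
  rw [Finset.sum_add_distrib, ← Finset.sum_smul]
  -- If `d` lies over `e`, the terms `f = d` and `f = d.op` give the product of the two weights with
  -- opposite signs; for a loop both come from the same `f`. Otherwise no term contributes.
  have h : ∑ f : DirEdge.Over e, weight μ f.dir * ((if f.dir = d then (1 : ℂ) else 0) *
      weight μ d.op - (if f.dir = d.op then (1 : ℂ) else 0) * weight μ d) = 0 := by
    simp only [mul_sub, Finset.sum_sub_distrib, mul_ite, ite_mul, mul_zero, one_mul, zero_mul]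
    by_cases hd : d.edge = e
    · have hsum (g : DirEdge.Over e → ℂ) (d' : DirEdge Λ) (hd' : d'.edge = e) :
          ∑ f, (if f.dir = d' then g f else 0) = g (d'.toOver hd') :=
        (Finset.sum_eq_single (d'.toOver hd')
          (fun f _ hf => if_neg fun h => hf (DirEdge.Over.ext h))
          (fun h => absurd (Finset.mem_univ _) h)).trans (if_pos rfl)
      rw [hsum _ d hd, hsum _ d.op hd]
      exact sub_eq_zero.2 (mul_comm _ _)
    · rw [Finset.sum_eq_zero fun f _ => if_neg fun h : f.dir = d => hd (h ▸ f.edge_dir),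
        Finset.sum_eq_zero fun f _ => if_neg fun h : f.dir = d.op =>
          hd ((congrArg DirEdge.edge h).symm.trans f.edge_dir), sub_self]
  rw [h, zero_smul, add_zero]

end Walks

/-! ### Generated algebras, intertwiners and the expectation -/

section Expectation

variable {α : Type u} {β : Type v} {Λ : Graph α β}

/-- A closed subalgebra which contains a self-adjoint set contains the C*-algebra generated by
this set. -/
lemma topologicalClosure_adjoin_subset {D : Type*} [CStarAlgebra D] {s : Set D}
    (hs : ∀ x ∈ s, star x ∈ s) (P : NonUnitalSubalgebra ℂ D) (hP : IsClosed (P : Set D))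
    (h : s ⊆ P) {x : D} (hx : x ∈ (NonUnitalStarAlgebra.adjoin ℂ s).topologicalClosure) :
    x ∈ P := by
  have h1 : (NonUnitalStarAlgebra.adjoin ℂ s : Set D) ⊆ P := by
    have : NonUnitalAlgebra.adjoin ℂ (s ∪ star s) ≤ P := by
      refine NonUnitalAlgebra.adjoin_le (Set.union_subset h fun y hy => h ?_)
      have := hs _ (Set.mem_star.1 hy)
      rwa [star_star] at this
    exact this
  exact closure_minimal h1 hP hx

lemma star_mem_generators {F : Set (FockOp Λ)} (hF : ∀ x ∈ F, star x = x) :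
    ∀ x ∈ Set.range (leftAction (Λ := Λ)) ∪ F, star x ∈ Set.range (leftAction (Λ := Λ)) ∪ F := by
  rintro _ (⟨c, rfl⟩ | hx)
  · exact Or.inl ⟨star c, (star_leftAction c).symm⟩
  · rw [hF _ hx]
    exact Or.inr hx

/-- This is the induction principle for the algebra. Because the generating set is closed under
`star`, `P` need not be; this allows one-sided conditions such as `decaying` or `intertwined`. -/
lemma freeGraphAlgebra_subset (μ : Vert Λ → ℝ) (P : NonUnitalSubalgebra ℂ (FockOp Λ))
    (hP : IsClosed (P : Set (FockOp Λ))) (h : ∀ c, leftAction c ∈ P) (h' : ∀ e, edgeOp μ e ∈ P)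
    {x : FockOp Λ} (hx : x ∈ freeGraphAlgebra Λ μ) : x ∈ P := by
  refine topologicalClosure_adjoin_subset (star_mem_generators ?_) P hP ?_ hx
  · rintro _ ⟨e, rfl⟩
    exact star_edgeOp μ e
  · rintro _ (⟨c, rfl⟩ | ⟨e, rfl⟩)
    exacts [h c, h' e]

lemma edgeAlgebra_subset (μ : Vert Λ → ℝ) (e : Edge Λ) (P : NonUnitalSubalgebra ℂ (FockOp Λ))
    (hP : IsClosed (P : Set (FockOp Λ))) (h : ∀ c, leftAction c ∈ P) (h' : edgeOp μ e ∈ P)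
    {x : FockOp Λ} (hx : x ∈ edgeAlgebra μ e) : x ∈ P := by
  refine topologicalClosure_adjoin_subset (star_mem_generators ?_) P hP ?_ hx
  · rintro _ rfl
    exact star_edgeOp μ e
  · rintro _ (⟨c, rfl⟩ | rfl)
    exacts [h c, h']

lemma leftAction_mem_edgeAlgebra (μ : Vert Λ → ℝ) (e : Edge Λ) (c : C₀(Vert Λ, ℂ)) :
    leftAction c ∈ edgeAlgebra μ e :=
  subset_closure (NonUnitalStarAlgebra.subset_adjoin ℂ _ (Or.inl ⟨c, rfl⟩))

lemma edgeOp_mem_edgeAlgebra (μ : Vert Λ → ℝ) (e : Edge Λ) : edgeOp μ e ∈ edgeAlgebra μ e :=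
  subset_closure (NonUnitalStarAlgebra.subset_adjoin ℂ _ (Or.inr rfl))

lemma leftAction_mem_freeGraphAlgebra (μ : Vert Λ → ℝ) (c : C₀(Vert Λ, ℂ)) :
    leftAction c ∈ freeGraphAlgebra Λ μ :=
  subset_closure (NonUnitalStarAlgebra.subset_adjoin ℂ _ (Or.inl ⟨c, rfl⟩))

lemma edgeOp_mem_freeGraphAlgebra (μ : Vert Λ → ℝ) (e : Edge Λ) :
    edgeOp μ e ∈ freeGraphAlgebra Λ μ :=
  subset_closure (NonUnitalStarAlgebra.subset_adjoin ℂ _ (Or.inr ⟨e, rfl⟩))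

lemma edgeAlgebra_le_freeGraphAlgebra (μ : Vert Λ → ℝ) (e : Edge Λ) :
    edgeAlgebra μ e ≤ freeGraphAlgebra Λ μ := fun _ hx =>
  edgeAlgebra_subset μ e (freeGraphAlgebra Λ μ).toNonUnitalSubalgebra isClosed_closure
    (leftAction_mem_freeGraphAlgebra μ) (edgeOp_mem_freeGraphAlgebra μ e) hx

lemma fiberHom_zero_apply (b : Vert Λ) (ξ : lp (fun _ : Walk b => ℂ) 2) :
    fiberHom b (0 : FockOp Λ) ξ = 0 := by
  rw [map_zero]; rfl

lemma fiberHom_add_apply (b : Vert Λ) (x y : FockOp Λ) (ξ : lp (fun _ : Walk b => ℂ) 2) :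
    fiberHom b (x + y) ξ = fiberHom b x ξ + fiberHom b y ξ := by
  rw [map_add]; rfl

lemma fiberHom_smul_apply (b : Vert Λ) (c : ℂ) (x : FockOp Λ)
    (ξ : lp (fun _ : Walk b => ℂ) 2) : fiberHom b (c • x) ξ = c • fiberHom b x ξ := by
  rw [map_smul]; rfl

lemma fiberHom_mul_apply (b : Vert Λ) (x y : FockOp Λ) (ξ : lp (fun _ : Walk b => ℂ) 2) :
    fiberHom b (x * y) ξ = fiberHom b x (fiberHom b y ξ) := by
  rw [map_mul]; rfl

lemma continuous_fiberHom_apply (b : Vert Λ) (ξ : lp (fun _ : Walk b => ℂ) 2) :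
    Continuous fun x : FockOp Λ => fiberHom b x ξ :=
  (continuous_fiberHom b).clm_apply continuous_const

/-- The operators on the Fock space whose fibres at `a` and `b` are intertwined by `X`. -/
def intertwined {a b : Vert Λ}
    (X : lp (fun _ : Walk a => ℂ) 2 →L[ℂ] lp (fun _ : Walk b => ℂ) 2) :
    NonUnitalSubalgebra ℂ (FockOp Λ) where
  carrier := {x | ∀ ξ, fiberHom b x (X ξ) = X (fiberHom a x ξ)}
  add_mem' {x y} hx hy ξ :=
    (fiberHom_add_apply b x y (X ξ)).trans ((congrArg₂ (· + ·) (hx ξ) (hy ξ)).trans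
      ((X.map_add _ _).symm.trans (congrArg X (fiberHom_add_apply a x y ξ).symm)))
  zero_mem' ξ := (fiberHom_zero_apply b (X ξ)).trans
    (X.map_zero.symm.trans (congrArg X (fiberHom_zero_apply a ξ).symm))
  mul_mem' {x y} hx hy ξ :=
    (fiberHom_mul_apply b x y (X ξ)).trans ((congrArg (fiberHom b x) (hy ξ)).trans
      ((hx (fiberHom a y ξ)).trans (congrArg X (fiberHom_mul_apply a x y ξ).symm)))
  smul_mem' c x hx ξ :=
    (fiberHom_smul_apply b c x (X ξ)).trans ((congrArg (c • ·) (hx ξ)).trans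
      ((X.map_smul c _).symm.trans (congrArg X (fiberHom_smul_apply a c x ξ).symm)))

lemma isClosed_intertwined {a b : Vert Λ}
    (X : lp (fun _ : Walk a => ℂ) 2 →L[ℂ] lp (fun _ : Walk b => ℂ) 2) :
    IsClosed (intertwined X : Set (FockOp Λ)) := by
  have : (intertwined X : Set (FockOp Λ)) =
      ⋂ ξ, {x | fiberHom b x (X ξ) = X (fiberHom a x ξ)} := by
    ext x
    rw [Set.mem_iInter]
    rfl
  rw [this]
  exact isClosed_iInter fun ξ => isClosed_eq (continuous_fiberHom_apply b _)
    (X.continuous.comp (continuous_fiberHom_apply a ξ))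

lemma apply_rightOp {μ : Vert Λ → ℝ} {x : FockOp Λ} (hx : x ∈ freeGraphAlgebra Λ μ)
    (d : DirEdge Λ) (ξ : lp (fun _ : Walk d.src => ℂ) 2) :
    fiberHom d.tgt x (rightOp μ d ξ) = rightOp μ d (fiberHom d.src x ξ) :=
  freeGraphAlgebra_subset μ (intertwined (rightOp μ d)) (isClosed_intertwined _)
    (fun c => DFunLike.congr_fun (leftAction_rightOp μ d c))
    (fun e => DFunLike.congr_fun (edgeOp_rightOp μ e d)) hx ξ

lemma apply_appendOp {μ : Vert Λ → ℝ} {e : Edge Λ} {x : FockOp Λ} (hx : x ∈ edgeAlgebra μ e)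
    {a b : Vert Λ} (v : Walk b) (hv : v.src = a)
    (hf : ∀ f : DirEdge Λ, f.edge = e → Walk.strip f v = none)
    (ξ : lp (fun _ : Walk a => ℂ) 2) :
    fiberHom b x (appendOp v hv ξ) = appendOp v hv (fiberHom a x ξ) :=
  edgeAlgebra_subset μ e (intertwined (appendOp v hv)) (isClosed_intertwined _)
    (fun c => DFunLike.congr_fun (leftAction_appendOp v hv c))
    (DFunLike.congr_fun (edgeOp_appendOp v hv μ e hf)) hx ξ

/-! ### The vacuum expectation -/

/-- The image of the walk of length zero at `a`. -/
def vacuumVec (x : FockOp Λ) (a : Vert Λ) : lp (fun _ : Walk a => ℂ) 2 :=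
  fiberHom a x (basisVec (Walk.nil a))

lemma norm_vacuumVec_le (x : FockOp Λ) (a : Vert Λ) : ‖vacuumVec x a‖ ≤ ‖x‖ :=
  ((fiberHom a x).le_opNorm _).trans (by
    rw [norm_basisVec, mul_one]
    exact norm_fiberHom_le a x)

lemma vacuumVec_add (x y : FockOp Λ) (a : Vert Λ) :
    vacuumVec (x + y) a = vacuumVec x a + vacuumVec y a := by
  exact fiberHom_add_apply _ _ _ _

lemma vacuumVec_smul (c : ℂ) (x : FockOp Λ) (a : Vert Λ) :
    vacuumVec (c • x) a = c • vacuumVec x a := by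
  exact fiberHom_smul_apply _ _ _ _

lemma vacuumVec_mul (x y : FockOp Λ) (a : Vert Λ) :
    vacuumVec (x * y) a = fiberHom a x (vacuumVec y a) := by
  exact fiberHom_mul_apply _ _ _ _

lemma vacuumVec_leftAction (c : C₀(Vert Λ, ℂ)) (a : Vert Λ) :
    vacuumVec (leftAction c) a = c a • basisVec (Walk.nil a) :=
  fiberHom_leftAction_basisVec c (Walk.nil a)

lemma norm_lp_apply_le {ι : Type*} (ξ : lp (fun _ : ι => ℂ) 2) (i : ι) : ‖ξ i‖ ≤ ‖ξ‖ :=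
  lp.norm_apply_le_norm (by simp) ξ i

/-- Only the right factor has to decay, since the left one is uniformly bounded on the fibres. So
the decaying operators form a left ideal. -/
lemma tendsto_norm_vacuumVec_mul (x : FockOp Λ) {y : FockOp Λ}
    (hy : Filter.Tendsto (fun a => ‖vacuumVec y a‖) Filter.cofinite (nhds 0)) :
    Filter.Tendsto (fun a => ‖vacuumVec (x * y) a‖) Filter.cofinite (nhds 0) := by
  refine squeeze_zero (fun _ => norm_nonneg _) (fun a => ?_)
    (by simpa using Filter.Tendsto.const_mul ‖x‖ hy)
  rw [vacuumVec_mul]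
  exact (fiberHom a x).le_of_opNorm_le (norm_fiberHom_le a x) _

variable (Λ) in
/-- The operators whose values on the walks of length zero vanish at infinity. -/
def decaying : NonUnitalSubalgebra ℂ (FockOp Λ) where
  carrier := {x | Filter.Tendsto (fun a => ‖vacuumVec x a‖) Filter.cofinite (nhds 0)}
  add_mem' {x y} hx hy := by
    refine squeeze_zero (fun _ => norm_nonneg _) (fun a => ?_)
      (by simpa using Filter.Tendsto.add hx hy)
    rw [vacuumVec_add]
    exact norm_add_le _ _
  zero_mem' := by
    have : (fun a : Vert Λ => ‖vacuumVec 0 a‖) = fun _ => 0 := funext fun a => by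
      rw [vacuumVec, map_zero]
      exact norm_zero
    change Filter.Tendsto _ _ _
    rw [this]
    exact tendsto_const_nhds
  mul_mem' {x _} _ hy := tendsto_norm_vacuumVec_mul x hy
  smul_mem' c x hx := by
    refine squeeze_zero (fun _ => norm_nonneg _) (fun a => ?_)
      (by simpa using Filter.Tendsto.const_mul ‖c‖ hx)
    rw [vacuumVec_smul]
    exact (norm_smul _ _).le

lemma decaying_left_mul (x : FockOp Λ) {y : FockOp Λ} (hy : y ∈ decaying Λ) :
    x * y ∈ decaying Λ := tendsto_norm_vacuumVec_mul x hy

lemma isClosed_decaying : IsClosed (decaying Λ : Set (FockOp Λ)) := by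
  refine isClosed_of_closure_subset fun x hx => ?_
  change Filter.Tendsto (fun a => ‖vacuumVec x a‖) Filter.cofinite (nhds 0)
  rw [Metric.tendsto_nhds]
  intro ε hε
  obtain ⟨y, hy, hd⟩ := Metric.mem_closure_iff.1 hx (ε / 2) (half_pos hε)
  have hy' : Filter.Tendsto (fun a => ‖vacuumVec y a‖) Filter.cofinite (nhds 0) := hy
  filter_upwards [(Metric.tendsto_nhds.1 hy') (ε / 2) (half_pos hε)] with a ha
  simp only [dist_zero_right, norm_norm] at ha ⊢
  rw [dist_eq_norm] at hd
  calc ‖vacuumVec x a‖ = ‖vacuumVec (x - y) a + vacuumVec y a‖ := by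
        rw [← vacuumVec_add, sub_add_cancel]
    _ ≤ ‖vacuumVec (x - y) a‖ + ‖vacuumVec y a‖ := norm_add_le _ _
    _ ≤ ‖x - y‖ + ‖vacuumVec y a‖ := by gcongr; exact norm_vacuumVec_le _ a
    _ < ε := by linarith

lemma leftAction_mem_decaying (c : C₀(Vert Λ, ℂ)) : leftAction c ∈ decaying Λ := by
  change Filter.Tendsto (fun a => ‖vacuumVec (leftAction c) a‖) Filter.cofinite (nhds 0)
  have h : (fun a => ‖vacuumVec (leftAction c) a‖) = fun a => ‖c a‖ := funext fun a => by
    rw [vacuumVec_leftAction, norm_smul, norm_basisVec, mul_one]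
  rw [h]
  simpa using (tendsto_cofinite c).norm

/-- Only the finitely many targets of directed edges over `e` have vacuum vectors not killed by
`T_e`. -/
lemma edgeOp_mem_decaying (μ : Vert Λ → ℝ) (e : Edge Λ) : edgeOp μ e ∈ decaying Λ := by
  change Filter.Tendsto (fun a => ‖vacuumVec (edgeOp μ e) a‖) Filter.cofinite (nhds 0)
  refine tendsto_nhds_of_eventually_eq ?_
  rw [Filter.eventually_cofinite]
  refine (Set.finite_range fun f : DirEdge.Over e => f.dir.tgt).subset fun a ha => ?_
  by_contra h
  refine ha ?_
  rw [vacuumVec, fiberHom_edgeOp, sum_apply, Finset.sum_eq_zero, norm_zero]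
  intro f _
  rw [smul_apply, fieldOp, add_apply,
    create_basisVec_of_ne _ _ fun h' => h ⟨f, h'⟩,
    create_adjoint_basisVec_of_none _ _ (Walk.strip_nil _), add_zero, smul_zero]

lemma mem_decaying {μ : Vert Λ → ℝ} {x : FockOp Λ} (hx : x ∈ freeGraphAlgebra Λ μ) :
    x ∈ decaying Λ :=
  freeGraphAlgebra_subset μ _ isClosed_decaying leftAction_mem_decaying (edgeOp_mem_decaying μ) hx

lemma vacuum_apply (c : C₀(Vert Λ, ℂ)) (b : Vert Λ) :
    (vacuum c).1 b = c b • basisVec (Walk.nil b) := rfl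

lemma apply_vacuum (x : FockOp Λ) (c : C₀(Vert Λ, ℂ)) (b : Vert Λ) :
    (x.1 (vacuum c)).1 b = c b • vacuumVec x b := by
  rw [apply_eq_fiberHom, vacuum_apply, map_smul]
  rfl

lemma inner_vacuum_apply (x : FockOp Λ) (c c' : C₀(Vert Λ, ℂ)) (b : Vert Λ) :
    (⟪vacuum c, x.1 (vacuum c')⟫_(C₀(Vert Λ, ℂ)) : C₀(Vert Λ, ℂ)) b =
      star (c b) * vacuumVec x b (Walk.nil b) * c' b := by
  rw [C0Sections.inner_apply, apply_vacuum, vacuum_apply, inner_smul_left, inner_smul_right,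
    inner_basisVec_left]
  change star (c b) * _ = _
  ring

lemma proj_same (a : Vert Λ) : proj a a = 1 := by
  classical
  exact Pi.single_eq_same (M := fun _ => ℂ) a 1

lemma proj_ne {a b : Vert Λ} (h : b ≠ a) : proj a b = 0 := by
  classical
  exact Pi.single_eq_of_ne (M := fun _ => ℂ) h 1

/-- The term at `a` is `g a` times the indicator function of `a`, so a partial sum is a truncation
of `g`. The error is small once the finite set where `g` is large is included. -/
lemma hasSum_expectationTerm {x : FockOp Λ} (hx : x ∈ decaying Λ) :
    ∃ g : C₀(Vert Λ, ℂ), (∀ a, g a = vacuumVec x a (Walk.nil a)) ∧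
      HasSum (expectationTerm x) g := by
  classical
  have h0 : Filter.Tendsto (fun a => vacuumVec x a (Walk.nil a)) Filter.cofinite (nhds 0) :=
    squeeze_zero_norm (fun a => norm_lp_apply_le _ _) hx
  let g : C₀(Vert Λ, ℂ) := mkC0 _ h0
  refine ⟨g, fun a => rfl, ?_⟩
  have hterm (a b : Vert Λ) : expectationTerm x a b = if b = a then g a else 0 := by
    rw [expectationTerm, inner_vacuum_apply]
    split_ifs with h
    · subst h
      rw [proj_same, star_one, one_mul, mul_one]
      rfl
    · rw [proj_ne h, mul_zero]
  rw [HasSum, SummationFilter.unconditional_filter, Metric.tendsto_nhds]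
  intro ε hε
  have h' : ∀ᶠ a in Filter.cofinite, ‖g a‖ < ε / 2 := by
    filter_upwards [(Metric.tendsto_nhds.1 (tendsto_cofinite g)) (ε / 2) (half_pos hε)] with a ha
    simpa using ha
  rw [Filter.eventually_cofinite] at h'
  filter_upwards [Filter.eventually_ge_atTop h'.toFinset] with s hs
  rw [dist_eq_norm]
  refine (norm_le_of_forall _ (half_pos hε).le fun b => ?_).trans_lt (half_lt_self hε)
  have hsum : (∑ a ∈ s, expectationTerm x a) b = if b ∈ s then g b else 0 := by
    rw [← Finset.sum_ite_eq s b g, ← Finset.sum_congr rfl fun a _ => hterm a b]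
    exact map_sum (⟨⟨fun f => f b, rfl⟩, fun _ _ => rfl⟩ : C₀(Vert Λ, ℂ) →+ ℂ) _ _
  rw [ZeroAtInftyContinuousMap.sub_apply, hsum]
  split_ifs with hb
  · rw [sub_self, norm_zero]
    exact (half_pos hε).le
  · rw [zero_sub, norm_neg]
    by_contra hlt
    exact hb (hs (by simpa using (not_le.1 hlt).le))

lemma expectation_apply {x : FockOp Λ} (hx : x ∈ decaying Λ) (a : Vert Λ) :
    expectation x a = vacuumVec x a (Walk.nil a) := by
  obtain ⟨g, hg, hs⟩ := hasSum_expectationTerm hx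
  rw [expectation, hs.tsum_eq, hg]

lemma expectation_star_mul_self_apply {x : FockOp Λ} (hx : star x * x ∈ decaying Λ)
    (a : Vert Λ) : expectation (star x * x) a = ((‖vacuumVec x a‖ : ℝ) : ℂ) ^ 2 := by
  rw [expectation_apply hx, vacuumVec_mul, fiberHom_star, ← inner_basisVec_left,
    ContinuousLinearMap.adjoint_inner_right]
  exact inner_self_eq_norm_sq_to_K (vacuumVec x a)

lemma isConditionalExpectationOn_expectation (μ : Vert Λ → ℝ) :
    IsConditionalExpectationOn leftAction expectation (freeGraphAlgebra Λ μ) where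
  map_add x hx y hy := by
    ext a
    rw [ZeroAtInftyContinuousMap.add_apply, expectation_apply (mem_decaying hx),
      expectation_apply (mem_decaying hy), expectation_apply (mem_decaying (add_mem hx hy)),
      vacuumVec_add]
    rfl
  map_smul c x hx := by
    ext a
    rw [ZeroAtInftyContinuousMap.smul_apply, expectation_apply (mem_decaying hx),
      expectation_apply ((decaying Λ).smul_mem c (mem_decaying hx)), vacuumVec_smul]
    rfl
  map_base c := by
    ext a
    rw [expectation_apply (leftAction_mem_decaying c), vacuumVec_leftAction]
    change c a * basisVec (Walk.nil a) (Walk.nil a) = _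
    rw [basisVec_self, mul_one]
  bimodule c c' x hx := by
    have h := mem_decaying hx
    have hc := leftAction_mem_decaying (Λ := Λ) c
    have hc' := leftAction_mem_decaying (Λ := Λ) c'
    ext a
    rw [expectation_apply (mul_mem (mul_mem hc h) hc'), ZeroAtInftyContinuousMap.mul_apply,
      ZeroAtInftyContinuousMap.mul_apply, expectation_apply h, vacuumVec_mul,
      vacuumVec_leftAction, map_smul, map_mul, mul_comm _ (c' a)]
    change c' a * fiberHom a (leftAction c) (vacuumVec x a) (Walk.nil a) = _
    rw [fiberHom_leftAction_apply]
    rfl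
  nonneg x hx := by
    have h : star x * x ∈ decaying Λ := mem_decaying (mul_mem (star_mem hx) hx)
    -- The function `‖x δ_a‖` is the square root of `E(x⋆x)`, and it vanishes at infinity because
    -- `x` is decaying.
    let g : C₀(Vert Λ, ℂ) := mkC0 (fun a => ((‖vacuumVec x a‖ : ℝ) : ℂ)) (by
      simpa [Function.comp_def] using
        (Complex.continuous_ofReal.tendsto 0).comp (mem_decaying hx))
    have hg : expectation (star x * x) = star g * g := by
      ext a
      rw [expectation_star_mul_self_apply h]
      change _ = star ((‖vacuumVec x a‖ : ℝ) : ℂ) * ((‖vacuumVec x a‖ : ℝ) : ℂ)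
      rw [Complex.star_def, Complex.conj_ofReal, sq]
    rw [hg]
    exact star_mul_self_nonneg g
  norm_le x hx := norm_le_of_forall _ (norm_nonneg _) fun a => by
    rw [expectation_apply (mem_decaying hx)]
    exact (norm_lp_apply_le _ _).trans (norm_vacuumVec_le x a)

/-! ### Faithfulness -/

lemma Walk.nil_or_append_single {b : Vert Λ} (w : Walk b) :
    w = Walk.nil b ∨ ∃ (d : DirEdge Λ) (h : d.tgt = b) (u : Walk d.src),
      w = (Walk.single d h).append (Walk.src_single d h) u := by
  obtain ⟨⟨a, l⟩, h⟩ := w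
  induction l generalizing a with
  | nil => exact Or.inl (Walk.ext h rfl)
  | cons f l ih =>
    refine Or.inr ?_
    obtain h' | ⟨d, hd, u, hu⟩ := ih f.tgt h.2
    · have h1 : f.tgt = b := congrArg (fun w : Walk b => w.1.1) h'
      have h2 : l = [] := congrArg (fun w : Walk b => w.1.2) h'
      exact ⟨f, h1, Walk.nil f.src, Walk.ext h.1 (by subst h2; rfl)⟩
    · refine ⟨d, hd, u.cons f (congrArg (fun w : Walk b => w.1.1) hu), Walk.ext h.1 ?_⟩
      exact congrArg (fun w : Walk b => f :: w.1.2) hu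

lemma Walk.length_append_single {b : Vert Λ} (d : DirEdge Λ) (h : d.tgt = b) {a : Vert Λ}
    (h' : (Walk.single d h).src = a) (u : Walk a) :
    ((Walk.single d h).append h' u).1.2.length = u.1.2.length + 1 := by
  simp [Walk.append, Walk.single]

lemma rightOp_basisVec (μ : Vert Λ → ℝ) (d : DirEdge Λ) (u : Walk d.src) :
    rightOp μ d (basisVec u) =
      weight μ d.op • basisVec ((Walk.single d rfl).append (Walk.src_single d rfl) u) +
        weight μ d • (rightCreate d.op d.src_op d.tgt_op).adjoint (basisVec u) := by
  rw [← rightCreate_basisVec]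
  rfl

/-- Right annihilation removes the last edge if this is `d`. The drop in length is what the
induction on walks needs. -/
lemma rightCreate_adjoint_basisVec {a b : Vert Λ} (d : DirEdge Λ) (ha : d.src = a)
    (hb : d.tgt = b) (u : Walk b) :
    (rightCreate d ha hb).adjoint (basisVec u) = 0 ∨ ∃ k : Walk a,
      k.1.2.length < u.1.2.length ∧ (rightCreate d ha hb).adjoint (basisVec u) = basisVec k := by
  rw [rightCreate, appendOp]
  by_cases hk : ∃ k, (Walk.single d hb).append ((Walk.src_single d hb).trans ha) k = u
  · obtain ⟨k, rfl⟩ := hk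
    exact Or.inr ⟨k, by rw [Walk.length_append_single]; exact Nat.lt_succ_self _,
      pushIsometry_adjoint_basisVec _ _ _⟩
  · exact Or.inl (pushIsometry_adjoint_basisVec_of_notMem _ _ _ (not_exists.1 hk))

/-- Split off the last edge: `rightOp μ d` maps the remaining walk `u` to a nonzero multiple of the
given walk plus a term which is zero or shorter than `u`. Since `x` passes through `rightOp μ d` and
kills `u`, it kills this sum, and by induction also the second term. -/
lemma fiberHom_basisVec_eq_zero {μ : Vert Λ → ℝ} (hμ : ∀ a, 0 < μ a) {x : FockOp Λ}
    (hx : x ∈ freeGraphAlgebra Λ μ) (h : ∀ a, vacuumVec x a = 0) (n : ℕ) (b : Vert Λ)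
    (w : Walk b) (hw : w.1.2.length < n) : fiberHom b x (basisVec w) = 0 := by
  induction n generalizing b w with
  | zero => exact absurd hw (Nat.not_lt_zero _)
  | succ n ih =>
    obtain rfl | ⟨d, rfl, u, rfl⟩ := w.nil_or_append_single
    · exact h b
    rw [Walk.length_append_single] at hw
    have hu : u.1.2.length < n := Nat.lt_of_succ_lt_succ hw
    have h1 := apply_rightOp hx d (basisVec u)
    have h2 : fiberHom d.tgt x ((rightCreate d.op d.src_op d.tgt_op).adjoint (basisVec u)) =
        0 := by
      obtain hk | ⟨k, hk, hk'⟩ := rightCreate_adjoint_basisVec d.op d.src_op d.tgt_op u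
      · rw [hk, map_zero]
      · rw [hk']
        exact ih _ k (hk.trans hu)
    rw [ih _ u hu, map_zero, rightOp_basisVec, map_add, map_smul, map_smul, h2, smul_zero,
      add_zero] at h1
    exact (smul_eq_zero.1 h1).resolve_left (weight_ne_zero hμ d.op)

lemma eq_zero_of_vacuumVec_eq_zero {μ : Vert Λ → ℝ} (hμ : ∀ a, 0 < μ a) {x : FockOp Λ}
    (hx : x ∈ freeGraphAlgebra Λ μ) (h : ∀ a, vacuumVec x a = 0) : x = 0 := by
  refine adjointable_ext_fiber fun b => clm_ext_basisVec fun w => ?_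
  rw [fiberHom_zero_apply]
  exact fiberHom_basisVec_eq_zero hμ hx h _ b w (Nat.lt_succ_self _)

lemma isFaithfulOn_expectation {μ : Vert Λ → ℝ} (hμ : ∀ a, 0 < μ a) :
    IsFaithfulOn expectation (freeGraphAlgebra Λ μ) := fun x hx h => by
  refine eq_zero_of_vacuumVec_eq_zero hμ hx fun a => ?_
  have h1 := expectation_star_mul_self_apply (mem_decaying (mul_mem (star_mem hx) hx)) a
  rw [h] at h1
  exact norm_eq_zero.1 (Complex.ofReal_eq_zero.1 (pow_eq_zero_iff two_ne_zero |>.1 h1.symm))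

end Expectation

/-! ### Supports of vectors and freeness -/

section Freeness

variable {α : Type u} {β : Type v} {Λ : Graph α β}

/-- The operators which preserve the vectors supported on a set of walks. -/
def supportPreserving {b : Vert Λ} (s : Set (Walk b)) : NonUnitalSubalgebra ℂ (FockOp Λ) where
  carrier := {x | ∀ ξ : lp (fun _ : Walk b => ℂ) 2, (∀ w ∉ s, ξ w = 0) →
    ∀ w ∉ s, fiberHom b x ξ w = 0}
  add_mem' {x y} hx hy ξ hξ w hw := by
    rw [fiberHom_add_apply]
    exact (congrArg₂ (· + ·) (hx ξ hξ w hw) (hy ξ hξ w hw)).trans (add_zero _)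
  zero_mem' ξ _ w _ := by
    rw [fiberHom_zero_apply]
    rfl
  mul_mem' {x y} hx hy ξ hξ w hw := by
    rw [fiberHom_mul_apply]
    exact hx _ (hy ξ hξ) w hw
  smul_mem' c x hx ξ hξ w hw := by
    rw [fiberHom_smul_apply]
    exact (congrArg (c * ·) (hx ξ hξ w hw)).trans (mul_zero c)

lemma isClosed_supportPreserving {b : Vert Λ} (s : Set (Walk b)) :
    IsClosed (supportPreserving s : Set (FockOp Λ)) := by
  have h : (supportPreserving s : Set (FockOp Λ)) =
      ⋂ (ξ : lp (fun _ : Walk b => ℂ) 2) (_ : ∀ w ∉ s, ξ w = 0) (w : Walk b) (_ : w ∉ s),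
        {x | ⟪basisVec w, fiberHom b x ξ⟫_ℂ = 0} := by
    ext x
    simp only [Set.mem_iInter, inner_basisVec_left]
    rfl
  rw [h]
  exact isClosed_iInter fun ξ => isClosed_iInter fun _ => isClosed_iInter fun w =>
    isClosed_iInter fun _ => isClosed_eq
      (continuous_const.inner (continuous_fiberHom_apply b ξ)) continuous_const

/-- The walks in the edges over `e`. -/
def walksOver (e : Edge Λ) (b : Vert Λ) : Set (Walk b) := {w | ∀ d ∈ w.1.2, d.edge = e}

lemma nil_mem_walksOver (e : Edge Λ) (b : Vert Λ) : Walk.nil b ∈ walksOver e b := fun _ hd =>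
  absurd hd List.not_mem_nil

lemma cons_mem_walksOver_iff {e : Edge Λ} {b : Vert Λ} {d : DirEdge Λ} {w : Walk b}
    (h : d.tgt = w.src) : w.cons d h ∈ walksOver e b ↔ d.edge = e ∧ w ∈ walksOver e b :=
  List.forall_mem_cons

/-- Adding or removing a first edge over `e` keeps a walk within the walks over `e`. The proof reads
this off the coefficients outside that set. -/
lemma edgeOp_mem_supportPreserving (μ : Vert Λ → ℝ) (e : Edge Λ) (b : Vert Λ) :
    edgeOp μ e ∈ supportPreserving (walksOver e b) := by
  intro ξ hξ w hw
  rw [fiberHom_edgeOp, sum_apply, ← inner_basisVec_left, inner_sum]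
  refine Finset.sum_eq_zero fun f _ => ?_
  rw [smul_apply, inner_smul_right, fieldOp, add_apply, inner_add_right, inner_basisVec_left,
    inner_basisVec_left]
  have h1 : create b f.dir ξ w = 0 := by
    rw [create_apply]
    cases hs : Walk.strip f.dir w with
    | none => rfl
    | some k =>
      refine hξ k fun hk => hw ?_
      obtain rfl | ⟨d, u, h, rfl⟩ := w.nil_or_cons
      · exact nil_mem_walksOver e b
      · by_cases hd : f.dir = d
        · subst hd
          rw [Walk.strip_cons_self] at hs
          cases hs
          exact (cons_mem_walksOver_iff h).2 ⟨f.edge_dir, hk⟩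
        · rw [Walk.strip_cons_of_ne hd] at hs
          cases hs
  have h2 : (create b f.dir).adjoint ξ w = 0 := by
    by_cases h : f.dir.tgt = w.src
    · rw [create_adjoint_apply _ _ _ h]
      exact hξ _ fun h' => hw ((cons_mem_walksOver_iff h).1 h').2
    · exact create_adjoint_apply_of_ne _ _ _ h
  rw [h1, h2, add_zero, mul_zero]

lemma vacuumVec_apply_eq_zero {μ : Vert Λ → ℝ} {e : Edge Λ} {x : FockOp Λ}
    (hx : x ∈ edgeAlgebra μ e) {b : Vert Λ} {w : Walk b} (hw : w ∉ walksOver e b) :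
    vacuumVec x b w = 0 := by
  refine edgeAlgebra_subset μ e (supportPreserving (walksOver e b))
    (isClosed_supportPreserving _) (fun c ξ hξ w hw => ?_)
    (edgeOp_mem_supportPreserving μ e b) hx (basisVec (Walk.nil b)) (fun w hw => ?_) w hw
  · rw [fiberHom_leftAction_apply, hξ w hw, mul_zero]
  · exact basisVec_ne fun h => hw (h ▸ nil_mem_walksOver e b)

/-- The walks whose first edge lies over `e`. -/
def walksStarting (e : Edge Λ) (b : Vert Λ) : Set (Walk b) :=
  {w | ∃ d : DirEdge Λ, d.edge = e ∧ ∃ l, w.1.2 = d :: l}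

lemma nil_notMem_walksStarting (e : Edge Λ) (b : Vert Λ) :
    Walk.nil b ∉ walksStarting e b := by
  rintro ⟨d, _, l, hl⟩
  exact absurd hl.symm (List.cons_ne_nil d l)

lemma notMem_walksStarting_of_ne {e e' : Edge Λ} (h : e ≠ e') {b : Vert Λ} {w : Walk b}
    (hw : w ∈ walksStarting e b) : w ∉ walksStarting e' b := by
  rintro ⟨d', rfl, l', hl'⟩
  obtain ⟨d, rfl, l, hl⟩ := hw
  exact h (congrArg DirEdge.edge (List.cons.inj (hl.symm.trans hl')).1)

lemma strip_eq_none_of_notMem {e : Edge Λ} {b : Vert Λ} {w : Walk b}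
    (hw : w ∉ walksStarting e b) (f : DirEdge Λ) (hf : f.edge = e) :
    Walk.strip f w = none := by
  obtain rfl | ⟨d, u, h, rfl⟩ := w.nil_or_cons
  · exact Walk.strip_nil f
  · exact Walk.strip_cons_of_ne (fun hfd : f = d => hw ⟨d, hfd ▸ hf, u.1.2, rfl⟩) u h

/-- This is the heart of freeness. Since `v` is a passive tail, a nonzero coefficient at `w` needs
`w = uv` with `u` a walk over `e`. A nonempty `u` would make `w` begin over `e`, and for empty `u`
the coefficient is a value of `E(x)`. -/
lemma fiberHom_basisVec_apply_eq_zero {μ : Vert Λ → ℝ} {e : Edge Λ} {x : FockOp Λ}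
    (hx : x ∈ edgeAlgebra μ e) (hE : expectation x = 0) {b : Vert Λ} {v w : Walk b}
    (hv : v ∉ walksStarting e b) (hw : w ∉ walksStarting e b) :
    fiberHom b x (basisVec v) w = 0 := by
  have h := apply_appendOp hx v rfl (strip_eq_none_of_notMem hv) (basisVec (Walk.nil v.src))
  rw [appendOp_basisVec, Walk.append_nil] at h
  rw [h, appendOp]
  by_cases hu : ∃ u, v.append rfl u = w
  · obtain ⟨u, rfl⟩ := hu
    rw [pushIsometry_apply_self]
    obtain rfl | ⟨d, u, hd, rfl⟩ := u.nil_or_cons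
    · have h0 := expectation_apply (mem_decaying (edgeAlgebra_le_freeGraphAlgebra μ e hx)) v.src
      rw [hE] at h0
      exact h0.symm
    · exact vacuumVec_apply_eq_zero hx fun hm =>
        hw ⟨d, ((cons_mem_walksOver_iff hd).1 hm).1, _, rfl⟩
  · exact pushIsometry_apply_of_notMem _ _ _ _ (not_exists.1 hu)

lemma fiberHom_apply_eq_zero {μ : Vert Λ → ℝ} {e : Edge Λ} {x : FockOp Λ}
    (hx : x ∈ edgeAlgebra μ e) (hE : expectation x = 0) {b : Vert Λ}
    {ξ : lp (fun _ : Walk b => ℂ) 2} (hξ : ∀ v ∈ walksStarting e b, ξ v = 0) {w : Walk b}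
    (hw : w ∉ walksStarting e b) : fiberHom b x ξ w = 0 := by
  have h := ((hasSum_basisVec ξ).mapL (fiberHom b x)).mapL (innerSL ℂ (basisVec w))
  have h0 (v : Walk b) : innerSL ℂ (basisVec w) (fiberHom b x (ξ v • basisVec v)) = 0 := by
    rw [map_smul, map_smul, innerSL_apply_apply, inner_basisVec_left]
    by_cases hv : v ∈ walksStarting e b
    · rw [hξ v hv, zero_smul]
    · rw [fiberHom_basisVec_apply_eq_zero hx hE hv hw, smul_zero]
  simp only [h0] at h
  rw [← inner_basisVec_left]
  exact h.unique hasSum_zero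

/-- The vector in the fibre at `a` obtained by applying a product of operators to the vacuum. -/
def wordVec (l : List (Edge Λ × FockOp Λ)) (a : Vert Λ) : lp (fun _ : Walk a => ℂ) 2 :=
  vacuumVec (l.map Prod.snd).prod a

lemma wordVec_nil (a : Vert Λ) :
    wordVec ([] : List (Edge Λ × FockOp Λ)) a = basisVec (Walk.nil a) := by
  change fiberHom a (1 : FockOp Λ) _ = _
  rw [map_one]
  rfl

lemma wordVec_cons (e : Edge Λ) (x : FockOp Λ) (l : List (Edge Λ × FockOp Λ)) (a : Vert Λ) :
    wordVec ((e, x) :: l) a = fiberHom a x (wordVec l a) := by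
  rw [wordVec, List.map_cons, List.prod_cons, vacuumVec_mul]
  rfl

lemma IsReducedWord.of_cons {ι B D : Type*} [NonUnitalCommCStarAlgebra B] [CStarAlgebra D]
    {A : ι → NonUnitalStarSubalgebra ℂ D} {E : D → B} {p : ι × D} {l : List (ι × D)}
    (h : IsReducedWord A E (p :: l)) : IsReducedWord A E l :=
  ⟨fun q hq => h.1 q (List.mem_cons_of_mem p hq), h.2.of_cons⟩

/-- Each centred factor moves vectors off the walks beginning over its edge into those walks. As
neighbouring edges differ, the result is again admissible for the next factor; the first half of the
statement is what the induction carries. -/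
lemma wordVec_apply_eq_zero {μ : Vert Λ → ℝ} (l : List (Edge Λ × FockOp Λ)) (e : Edge Λ)
    (x : FockOp Λ) (h : IsReducedWord (edgeAlgebra μ) expectation ((e, x) :: l)) (a : Vert Λ) :
    (∀ w ∈ walksStarting e a, wordVec l a w = 0) ∧
      ∀ w ∉ walksStarting e a, wordVec ((e, x) :: l) a w = 0 := by
  have hx := h.1 _ List.mem_cons_self
  have key : ∀ w ∈ walksStarting e a, wordVec l a w = 0 := by
    induction l generalizing e x with
    | nil =>
      intro w hw
      rw [wordVec_nil]
      exact basisVec_ne fun h => nil_notMem_walksStarting e a (h ▸ hw)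
    | cons p l ih =>
      intro w hw
      have hp := h.of_cons.1 _ List.mem_cons_self
      have hne : e ≠ p.1 := (List.isChain_cons_cons.1 h.2).1
      exact (wordVec_cons p.1 p.2 l a) ▸ fiberHom_apply_eq_zero hp.1 hp.2
        (ih p.1 p.2 h.of_cons hp) (notMem_walksStarting_of_ne hne hw)
  refine ⟨key, fun w hw => ?_⟩
  rw [wordVec_cons]
  exact fiberHom_apply_eq_zero hx.1 hx.2 key hw

/-- The empty word is excluded because its product `1` is not in the algebra when `V` is infinite.
-/
lemma prod_mem_freeGraphAlgebra {μ : Vert Λ → ℝ} {l : List (Edge Λ × FockOp Λ)} (hl : l ≠ [])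
    (h : IsReducedWord (edgeAlgebra μ) expectation l) :
    (l.map Prod.snd).prod ∈ freeGraphAlgebra Λ μ := by
  induction l with
  | nil => exact absurd rfl hl
  | cons p l ih =>
    have hp := edgeAlgebra_le_freeGraphAlgebra μ p.1 (h.1 p List.mem_cons_self).1
    rw [List.map_cons, List.prod_cons]
    by_cases hl' : l = []
    · subst hl'
      rwa [List.map_nil, List.prod_nil, mul_one]
    · exact mul_mem hp (ih hl' h.of_cons)

lemma isFreeWithAmalgamation_edgeAlgebra (μ : Vert Λ → ℝ) :
    IsFreeWithAmalgamation (edgeAlgebra μ) (expectation (Λ := Λ)) := fun l hl h => by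
  ext a
  rw [expectation_apply (mem_decaying (prod_mem_freeGraphAlgebra hl h))]
  cases l with
  | nil => exact absurd rfl hl
  | cons p l =>
    exact (wordVec_apply_eq_zero l p.1 p.2 h a).2 _ (nil_notMem_walksStarting p.1 a)

/-! ### Inner products of reduced words -/

lemma inner_eq_zero_of_support {ι : Type*} (s : Set ι) {ξ η : lp (fun _ : ι => ℂ) 2}
    (hξ : ∀ i ∈ s, ξ i = 0) (hη : ∀ i ∉ s, η i = 0) : ⟪ξ, η⟫_ℂ = 0 := by
  rw [lp.inner_eq_tsum]
  refine (tsum_congr fun i => ?_).trans tsum_zero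
  by_cases hi : i ∈ s
  · rw [hξ i hi, inner_zero_left]
  · rw [hη i hi, inner_zero_right]

lemma inner_fiberHom_left (x : FockOp Λ) (a : Vert Λ) (ξ η : lp (fun _ : Walk a => ℂ) 2) :
    ⟪fiberHom a x ξ, η⟫_ℂ = ⟪ξ, fiberHom a (star x) η⟫_ℂ := by
  rw [fiberHom_star, ContinuousLinearMap.adjoint_inner_right]

/-- Such operators are diagonal in the walks. The alternative `c = 1` is kept because the recursion
of `wordInner` starts at `1`, which need not come from `C₀(V)`, and continues with elements of
`C₀(V)`. -/
lemma fiberHom_apply_of_base {c : FockOp Λ} (hc : c = 1 ∨ ∃ c', c = leftAction c') (a : Vert Λ)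
    (ξ : lp (fun _ : Walk a => ℂ) 2) (w : Walk a) (h : ξ w = 0) : fiberHom a c ξ w = 0 := by
  obtain rfl | ⟨c, rfl⟩ := hc
  · rw [map_one]
    exact h
  · rw [fiberHom_leftAction_apply, h, mul_zero]

lemma sub_expectation_mem {μ : Vert Λ → ℝ} {e : Edge Λ} {x : FockOp Λ}
    (hx : x ∈ edgeAlgebra μ e) : x - leftAction (expectation x) ∈ edgeAlgebra μ e ∧
      expectation (x - leftAction (expectation x)) = 0 := by
  have h1 := mem_decaying (edgeAlgebra_le_freeGraphAlgebra μ e hx)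
  have h2 : x - leftAction (expectation x) ∈ edgeAlgebra μ e :=
    sub_mem hx (leftAction_mem_edgeAlgebra μ e _)
  have h3 := leftAction_mem_decaying (Λ := Λ) (expectation x)
  refine ⟨h2, ?_⟩
  ext a
  rw [expectation_apply (mem_decaying (edgeAlgebra_le_freeGraphAlgebra μ e h2))]
  have h4 : vacuumVec (x - leftAction (expectation x)) a =
      vacuumVec x a - vacuumVec (leftAction (expectation x)) a := by
    rw [eq_sub_iff_add_eq, ← vacuumVec_add, sub_add_cancel]
  rw [h4, vacuumVec_leftAction, expectation_apply h1]
  change _ - _ * basisVec (Walk.nil a) (Walk.nil a) = _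
  rw [basisVec_self, mul_one, sub_self]
  rfl

lemma mul_base_mem {μ : Vert Λ → ℝ} {e : Edge Λ} {x c : FockOp Λ} (hx : x ∈ edgeAlgebra μ e)
    (hc : c = 1 ∨ ∃ c', c = leftAction c') : x * c ∈ edgeAlgebra μ e := by
  obtain rfl | ⟨c, rfl⟩ := hc
  · rwa [mul_one]
  · exact mul_mem hx (leftAction_mem_edgeAlgebra μ e c)

/-- Move `x` and `c` to the right side and split `star x * c * y` into its centred part and its
expectation. The centred part sends the vector of `l'` into the walks beginning over `e`, where the
vector of `l` vanishes, so only the expectation contributes. -/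
lemma inner_wordVec_cons {μ : Vert Λ → ℝ} {e : Edge Λ} {x y : FockOp Λ}
    {l l' : List (Edge Λ × FockOp Λ)}
    (h : IsReducedWord (edgeAlgebra μ) expectation ((e, x) :: l))
    (h' : IsReducedWord (edgeAlgebra μ) expectation ((e, y) :: l')) {c : FockOp Λ}
    (hc : c = 1 ∨ ∃ c', c = leftAction c') (a : Vert Λ) :
    ⟪wordVec ((e, x) :: l) a, fiberHom a c (wordVec ((e, y) :: l') a)⟫_ℂ =
      ⟪wordVec l a, fiberHom a (leftAction (expectation (star x * c * y)))
        (wordVec l' a)⟫_ℂ := by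
  have hz : star x * c * y ∈ edgeAlgebra μ e :=
    mul_mem (mul_base_mem (star_mem (h.1 _ List.mem_cons_self).1) hc)
      (h'.1 _ List.mem_cons_self).1
  have h1 : fiberHom a (star x) (fiberHom a c (fiberHom a y (wordVec l' a))) =
      fiberHom a (star x * c * y) (wordVec l' a) :=
    (fiberHom_mul_apply a (star x) c _).symm.trans (fiberHom_mul_apply a (star x * c) y _).symm
  rw [wordVec_cons, wordVec_cons, inner_fiberHom_left, h1]
  generalize star x * c * y = z at hz
  have hz' := sub_expectation_mem hz
  have h0 : ⟪wordVec l a, fiberHom a (z - leftAction (expectation z)) (wordVec l' a)⟫_ℂ = 0 :=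
    inner_eq_zero_of_support (walksStarting e a) (wordVec_apply_eq_zero l e x h a).1
      fun w hw => fiberHom_apply_eq_zero hz'.1 hz'.2 (wordVec_apply_eq_zero l' e y h' a).1 hw
  have h2 : fiberHom a z (wordVec l' a) =
      fiberHom a (z - leftAction (expectation z)) (wordVec l' a) +
        fiberHom a (leftAction (expectation z)) (wordVec l' a) :=
    (congrArg (fun t => fiberHom a t (wordVec l' a)) (sub_add_cancel z _).symm).trans
      (fiberHom_add_apply a _ _ _)
  rw [h2, inner_add_right, h0, zero_add]

lemma expectation_base_mul_base_apply (b b' : C₀(Vert Λ, ℂ)) (c : FockOp Λ) (a : Vert Λ) :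
    expectation (star (leftAction b) * c * leftAction b') a =
      star (b a) * vacuumVec c a (Walk.nil a) * b' a := by
  -- The rightmost factor decays, so nothing is required of `c`.
  have h : star (leftAction b) * c * leftAction b' ∈ decaying Λ :=
    (decaying_left_mul _ (leftAction_mem_decaying b'))
  rw [expectation_apply h, vacuumVec_mul, vacuumVec_leftAction, map_smul, star_leftAction]
  change b' a * vacuumVec (leftAction (star b) * c) a (Walk.nil a) = _
  rw [vacuumVec_mul, fiberHom_leftAction_apply, mul_comm]
  rfl

lemma inner_wordVec {μ : Vert Λ → ℝ} (b b' : C₀(Vert Λ, ℂ)) (a : Vert Λ)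
    (l l' : List (Edge Λ × FockOp Λ)) (h : IsReducedWord (edgeAlgebra μ) expectation l)
    (h' : IsReducedWord (edgeAlgebra μ) expectation l') (c : FockOp Λ)
    (hc : c = 1 ∨ ∃ c', c = leftAction c') :
    star (b a) * ⟪wordVec l a, fiberHom a c (wordVec l' a)⟫_ℂ * b' a =
      wordInner leftAction expectation b b' l l' c a := by
  induction l generalizing l' c with
  | nil =>
    rw [wordVec_nil, inner_basisVec_left]
    cases l' with
    | nil =>
      rw [wordInner, expectation_base_mul_base_apply, wordVec_nil]
      rfl
    | cons p l' =>
      rw [wordInner, fiberHom_apply_of_base hc a _ _ ((wordVec_apply_eq_zero l' p.1 p.2 h' a).2 _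
        (nil_notMem_walksStarting p.1 a)), mul_zero, zero_mul]
      · rfl
      all_goals simp
  | cons p l ih =>
    obtain ⟨e, x⟩ := p
    have hl := wordVec_apply_eq_zero l e x h a
    cases l' with
    | nil =>
      -- A nonempty reduced word has no vacuum component, while the other vector is a multiple of
      -- the vacuum.
      rw [wordInner, inner_eq_zero_of_support {Walk.nil a}, mul_zero, zero_mul]
      · rfl
      · rintro _ rfl
        exact hl.2 _ (nil_notMem_walksStarting e a)
      · intro w hw
        rw [wordVec_nil]
        exact fiberHom_apply_of_base hc a _ _ (basisVec_ne hw)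
      all_goals simp
    | cons p l' =>
      obtain ⟨e', y⟩ := p
      have hl' := wordVec_apply_eq_zero l' e' y h' a
      rw [wordInner]
      split_ifs with hee
      · subst hee
        rw [← ih l' h.of_cons h'.of_cons _ (Or.inr ⟨_, rfl⟩), inner_wordVec_cons h h' hc]
      -- Different first edges give vectors with disjoint supports.
      · rw [inner_eq_zero_of_support (walksStarting e' a) (fun w hw => hl.2 w
          (notMem_walksStarting_of_ne (Ne.symm hee) hw))
          (fun w hw => fiberHom_apply_of_base hc a _ _ (hl'.2 w hw)), mul_zero, zero_mul]
        rfl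

end Freeness

/-! ### The Fock space as the free product module -/

section ReducedFreeProduct

variable {α : Type u} {β : Type v} {Λ : Graph α β}

/-- The vector obtained by applying the operators of a word to the vacuum. -/
def fockVec (l : List (Edge Λ × FockOp Λ)) (b : C₀(Vert Λ, ℂ)) : Fock Λ :=
  (l.map Prod.snd).prod.1 (vacuum b)

lemma fockVec_cons (e : Edge Λ) (x : FockOp Λ) (l : List (Edge Λ × FockOp Λ))
    (b : C₀(Vert Λ, ℂ)) : fockVec ((e, x) :: l) b = x.1 (fockVec l b) := by
  rw [fockVec, List.map_cons, List.prod_cons]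
  rfl

lemma fockVec_nil (b : C₀(Vert Λ, ℂ)) :
    fockVec ([] : List (Edge Λ × FockOp Λ)) b = vacuum b := rfl

lemma fockVec_apply (l : List (Edge Λ × FockOp Λ)) (b : C₀(Vert Λ, ℂ)) (a : Vert Λ) :
    (fockVec l b).1 a = b a • wordVec l a := apply_vacuum _ b a

lemma inner_fockVec {μ : Vert Λ → ℝ} {l l' : List (Edge Λ × FockOp Λ)}
    (h : IsReducedWord (edgeAlgebra μ) expectation l)
    (h' : IsReducedWord (edgeAlgebra μ) expectation l') (b b' : C₀(Vert Λ, ℂ)) :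
    ⟪fockVec l b, fockVec l' b'⟫_(C₀(Vert Λ, ℂ)) =
      wordInner leftAction expectation b b' l l' 1 := by
  ext a
  rw [← inner_wordVec b b' a l l' h h' 1 (Or.inl rfl), C0Sections.inner_apply, fockVec_apply,
    fockVec_apply, inner_smul_left, inner_smul_right, map_one]
  change star (b a) * (b' a * ⟪wordVec l a, wordVec l' a⟫_ℂ) =
    star (b a) * ⟪wordVec l a, wordVec l' a⟫_ℂ * b' a
  ring

lemma leftAction_vacuum (c b : C₀(Vert Λ, ℂ)) :
    (leftAction c).1 (vacuum b) = vacuum (c * b) := by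
  refine C0Sections.ext fun a => ?_
  rw [apply_vacuum, vacuumVec_leftAction, vacuum_apply, smul_smul, mul_comm]
  rfl

lemma leftAction_fockVec (c : C₀(Vert Λ, ℂ)) (l : List (Edge Λ × FockOp Λ))
    (b : C₀(Vert Λ, ℂ)) :
    (leftAction c).1 (fockVec l b) = baseAction leftAction fockVec c l b := by
  cases l with
  | nil => exact leftAction_vacuum c b
  | cons p l =>
    obtain ⟨e, x⟩ := p
    rw [baseAction, fockVec_cons, fockVec_cons]
    rfl

lemma sub_apply_add_apply (x y : FockOp Λ) (ξ : Fock Λ) : (x - y).1 ξ + y.1 ξ = x.1 ξ :=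
  sub_add_cancel (x.1 ξ) (y.1 ξ)

/-- The canonical action is only the splitting of an operator `z` into `z - E(z)` and `E(z)`, with
`z` equal to `x`, or to `x` times the first letter. It therefore holds for arbitrary operators and
words. -/
lemma apply_fockVec (e : Edge Λ) (x : FockOp Λ) (l : List (Edge Λ × FockOp Λ))
    (b : C₀(Vert Λ, ℂ)) :
    x.1 (fockVec l b) = factorAction leftAction expectation fockVec e x l b := by
  cases l with
  | nil => rw [factorAction, ← leftAction_fockVec, fockVec_cons, sub_apply_add_apply]
  | cons p l =>
    obtain ⟨k, y⟩ := p
    rw [factorAction]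
    split_ifs with hk
    · rw [← leftAction_fockVec, fockVec_cons, fockVec_cons, sub_apply_add_apply]
      rfl
    · rw [← leftAction_fockVec, fockVec_cons e, sub_apply_add_apply]

lemma expectation_leftAction_mul {x : FockOp Λ} (hx : x ∈ decaying Λ) (c : C₀(Vert Λ, ℂ)) :
    expectation (leftAction c * x) = c * expectation x := by
  ext a
  rw [expectation_apply (decaying_left_mul _ hx), vacuumVec_mul, fiberHom_leftAction_apply,
    ZeroAtInftyContinuousMap.mul_apply, expectation_apply hx]
  rfl

/-! ### Density of the reduced words -/

variable (Λ) in
/-- The span of the vectors of reduced words. -/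
def reducedSpan (μ : Vert Λ → ℝ) : Submodule ℂ (Fock Λ) :=
  Submodule.span ℂ {ξ | ∃ w b, IsReducedWord (edgeAlgebra μ) expectation w ∧ ξ = fockVec w b}

lemma fockVec_mem_reducedSpan {μ : Vert Λ → ℝ} {l : List (Edge Λ × FockOp Λ)}
    (h : IsReducedWord (edgeAlgebra μ) expectation l) (b : C₀(Vert Λ, ℂ)) :
    fockVec l b ∈ reducedSpan Λ μ := Submodule.subset_span ⟨l, b, h, rfl⟩

lemma isReducedWord_nil (μ : Vert Λ → ℝ) :
    IsReducedWord (edgeAlgebra μ) (expectation (Λ := Λ)) [] :=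
  ⟨fun _ h => absurd h List.not_mem_nil, List.isChain_nil⟩

lemma IsReducedWord.cons {μ : Vert Λ → ℝ} {e : Edge Λ} {x : FockOp Λ}
    {l : List (Edge Λ × FockOp Λ)} (hl : IsReducedWord (edgeAlgebra μ) expectation l)
    (hx : x ∈ edgeAlgebra μ e) (hE : expectation x = 0) (h : ∀ p ∈ l.head?, e ≠ p.1) :
    IsReducedWord (edgeAlgebra μ) expectation ((e, x) :: l) := by
  refine ⟨fun p hp => ?_, List.isChain_cons.2 ⟨h, hl.2⟩⟩
  obtain rfl | hp := List.mem_cons.1 hp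
  · exact ⟨hx, hE⟩
  · exact hl.1 p hp

lemma IsReducedWord.head_ne {μ : Vert Λ → ℝ} {p : Edge Λ × FockOp Λ}
    {l : List (Edge Λ × FockOp Λ)} (hl : IsReducedWord (edgeAlgebra μ) expectation (p :: l)) :
    ∀ q ∈ l.head?, p.1 ≠ q.1 := (List.isChain_cons.1 hl.2).1

lemma leftAction_fockVec_mem {μ : Vert Λ → ℝ} (c : C₀(Vert Λ, ℂ))
    {l : List (Edge Λ × FockOp Λ)} (h : IsReducedWord (edgeAlgebra μ) expectation l)
    (b : C₀(Vert Λ, ℂ)) : (leftAction c).1 (fockVec l b) ∈ reducedSpan Λ μ := by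
  rw [leftAction_fockVec]
  cases l with
  | nil => exact fockVec_mem_reducedSpan h _
  | cons p l =>
    obtain ⟨e, x⟩ := p
    obtain ⟨hx, hE⟩ := h.1 _ List.mem_cons_self
    refine fockVec_mem_reducedSpan (h.of_cons.cons
      (mul_mem (leftAction_mem_edgeAlgebra μ e c) hx) ?_ h.head_ne) _
    rw [expectation_leftAction_mul (mem_decaying (edgeAlgebra_le_freeGraphAlgebra μ e hx))]
    exact (congrArg (c * ·) hE).trans (mul_zero c)

/-- If the word begins with a letter from the same `S_e`, this letter is first absorbed into `x`. In
both cases an element of `S_e` then acts on a reduced word not beginning over `e`, and splitting off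
its expectation gives two vectors in the span. -/
lemma apply_fockVec_mem {μ : Vert Λ → ℝ} {e : Edge Λ} {x : FockOp Λ}
    (hx : x ∈ edgeAlgebra μ e) {l : List (Edge Λ × FockOp Λ)}
    (h : IsReducedWord (edgeAlgebra μ) expectation l) (b : C₀(Vert Λ, ℂ)) :
    x.1 (fockVec l b) ∈ reducedSpan Λ μ := by
  have key (l : List (Edge Λ × FockOp Λ)) (h : IsReducedWord (edgeAlgebra μ) expectation l)
      (hl : ∀ p ∈ l.head?, e ≠ p.1) (x : FockOp Λ) (hx : x ∈ edgeAlgebra μ e) :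
      x.1 (fockVec l b) ∈ reducedSpan Λ μ := by
    rw [← sub_apply_add_apply x (leftAction (expectation x)), ← fockVec_cons e]
    exact add_mem (fockVec_mem_reducedSpan (h.cons (sub_expectation_mem hx).1
      (sub_expectation_mem hx).2 hl) b) (leftAction_fockVec_mem _ h b)
  cases l with
  | nil => exact key [] h (by simp) x hx
  | cons p l =>
    obtain ⟨k, y⟩ := p
    by_cases hk : e = k
    · subst hk
      rw [fockVec_cons]
      exact key l h.of_cons h.head_ne (x * y) (mul_mem hx (h.1 _ List.mem_cons_self).1)
    · exact key _ h (by simpa using hk) x hx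

lemma apply_mem_closure {F : Type*} [NormedAddCommGroup F] [NormedSpace ℂ F] {s : Set F}
    (T : F →L[ℂ] F) (h : ∀ ξ ∈ s, T ξ ∈ Submodule.span ℂ s) {ξ : F}
    (hξ : ξ ∈ (Submodule.span ℂ s).topologicalClosure) :
    T ξ ∈ (Submodule.span ℂ s).topologicalClosure :=
  map_mem_closure T.continuous hξ fun _ hη =>
    (Submodule.span_le (p := (Submodule.span ℂ s).comap T.toLinearMap)).2 h hη

/-- The vectors in the fibre at `b` which lie in the closed span of the reduced words. -/
def reducedFiber (μ : Vert Λ → ℝ) (b : Vert Λ) : Submodule ℂ (lp (fun _ : Walk b => ℂ) 2) :=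
  (reducedSpan Λ μ).topologicalClosure.comap
    (C0Sections.single (H := fun b : Vert Λ => lp (fun _ : Walk b => ℂ) 2) b).toLinearMap

lemma mem_reducedFiber {μ : Vert Λ → ℝ} {b : Vert Λ} {ξ : lp (fun _ : Walk b => ℂ) 2} :
    ξ ∈ reducedFiber μ b ↔ C0Sections.single b ξ ∈ (reducedSpan Λ μ).topologicalClosure :=
  Iff.rfl

lemma fiberHom_edgeOp_mem_reducedFiber {μ : Vert Λ → ℝ} {b : Vert Λ} (e : Edge Λ)
    {ξ : lp (fun _ : Walk b => ℂ) 2} (hξ : ξ ∈ reducedFiber μ b) :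
    fiberHom b (edgeOp μ e) ξ ∈ reducedFiber μ b := by
  rw [mem_reducedFiber, ← apply_single]
  refine apply_mem_closure _ ?_ hξ
  rintro _ ⟨l, c, hl, rfl⟩
  exact apply_fockVec_mem (edgeOp_mem_edgeAlgebra μ e) hl c

lemma fiberHom_leftAction_mem_reducedFiber {μ : Vert Λ → ℝ} {b : Vert Λ} (c : C₀(Vert Λ, ℂ))
    {ξ : lp (fun _ : Walk b => ℂ) 2} (hξ : ξ ∈ reducedFiber μ b) :
    fiberHom b (leftAction c) ξ ∈ reducedFiber μ b := by
  rw [mem_reducedFiber, ← apply_single]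
  refine apply_mem_closure _ ?_ hξ
  rintro _ ⟨l, c', hl, rfl⟩
  exact leftAction_fockVec_mem c hl c'

lemma basisVec_nil_mem_reducedFiber (μ : Vert Λ → ℝ) (b : Vert Λ) :
    basisVec (Walk.nil b) ∈ reducedFiber μ b := by
  have h : C0Sections.single b (basisVec (Walk.nil b)) = vacuum (proj b) := by
    refine C0Sections.ext fun a => ?_
    rw [vacuum_apply]
    by_cases h : a = b
    · subst h
      rw [C0Sections.single_apply_same, proj_same, one_smul]
    · rw [C0Sections.single_apply_ne h, proj_ne h, zero_smul]
  rw [mem_reducedFiber, h]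
  exact subset_closure (fockVec_mem_reducedSpan (isReducedWord_nil μ) (proj b))

/-- Among directed edges over one edge with the same target, the source determines the edge. Hence
the projection at the source of `d` removes every other creation term. -/
lemma proj_create_basisVec {b : Vert Λ} {d f : DirEdge Λ} (hdf : d.edge = f.edge) (w : Walk b)
    (h : d.tgt = w.src) (hfd : f ≠ d) :
    fiberHom b (leftAction (proj d.src)) (create b f (basisVec w)) = 0 := by
  by_cases hf : f.tgt = w.src
  · rw [create_basisVec f w hf, fiberHom_leftAction_basisVec]
    have : (w.cons f hf).src ≠ d.src := fun hs =>
      hfd (DirEdge.ext hdf.symm hs (hf.trans h.symm))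
    rw [proj_ne this, zero_smul]
  · rw [create_basisVec_of_ne f w hf, map_zero]

lemma proj_create_basisVec_self {b : Vert Λ} (d : DirEdge Λ) (w : Walk b)
    (h : d.tgt = w.src) :
    fiberHom b (leftAction (proj d.src)) (create b d (basisVec w)) = basisVec (w.cons d h) := by
  rw [create_basisVec d w h, fiberHom_leftAction_basisVec]
  exact (congrArg (· • basisVec (w.cons d h)) (proj_same d.src)).trans (one_smul ℂ _)

/-- Subtracting the annihilation terms leaves the creation part of `T_e δ_w`, from which the
projection selects `d`. This writes a walk in terms of shorter ones and operators preserving the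
closed span. -/
lemma weight_smul_basisVec_cons (μ : Vert Λ → ℝ) {b : Vert Λ} (d : DirEdge Λ) (w : Walk b)
    (h : d.tgt = w.src) :
    weight μ d • basisVec (w.cons d h) = fiberHom b (leftAction (proj d.src))
      (fiberHom b (edgeOp μ d.edge) (basisVec w) - ∑ f : DirEdge.Over d.edge,
        weight μ f.dir • (create b f.dir).adjoint (basisVec w)) := by
  have h1 : fiberHom b (edgeOp μ d.edge) (basisVec w) - ∑ f : DirEdge.Over d.edge,
      weight μ f.dir • (create b f.dir).adjoint (basisVec w) =
      ∑ f : DirEdge.Over d.edge, weight μ f.dir • create b f.dir (basisVec w) := by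
    rw [fiberHom_edgeOp, sum_apply, ← Finset.sum_sub_distrib]
    refine Finset.sum_congr rfl fun f _ => ?_
    rw [smul_apply, fieldOp, add_apply, smul_add, add_sub_cancel_right]
  rw [h1, map_sum, Finset.sum_eq_single (d.toOver rfl)]
  · rw [map_smul, DirEdge.dir_toOver, proj_create_basisVec_self d w h]
  · intro f _ hf
    rw [map_smul, proj_create_basisVec f.edge_dir.symm w h
      (fun hfd => hf (DirEdge.Over.ext hfd)), smul_zero]
  · exact fun h => absurd (Finset.mem_univ _) h

lemma basisVec_mem_reducedFiber {μ : Vert Λ → ℝ} (hμ : ∀ a, 0 < μ a) {b : Vert Λ} (n : ℕ)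
    (w : Walk b) (hw : w.1.2.length < n) : basisVec w ∈ reducedFiber μ b := by
  induction n generalizing w with
  | zero => exact absurd hw (Nat.not_lt_zero _)
  | succ n ih =>
    obtain rfl | ⟨d, w, h, rfl⟩ := w.nil_or_cons
    · exact basisVec_nil_mem_reducedFiber μ b
    have hw' : w.1.2.length < n := Nat.lt_of_succ_lt_succ hw
    rw [← (reducedFiber μ b).smul_mem_iff (weight_ne_zero hμ d), weight_smul_basisVec_cons]
    refine fiberHom_leftAction_mem_reducedFiber _ (sub_mem
      (fiberHom_edgeOp_mem_reducedFiber _ (ih w hw')) (sum_mem fun f _ =>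
        Submodule.smul_mem _ _ ?_))
    obtain rfl | ⟨f', u, hu, rfl⟩ := w.nil_or_cons
    · rw [create_adjoint_basisVec_of_none _ _ (Walk.strip_nil _)]
      exact zero_mem _
    · by_cases hf : f.dir = f'
      · rw [hf, create_adjoint_basisVec_cons]
        -- Annihilation has removed a further edge, so `u` is shorter than the walk to which
        -- induction was already applied.
        exact ih u ((Nat.lt_succ_self _).trans hw')
      · rw [create_adjoint_basisVec_of_none _ _ (Walk.strip_cons_of_ne hf _ _)]
        exact zero_mem _

/-- All walks lie in the closed span; summing over walks gives each fibre, and summing over fibres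
gives every section. -/
lemma closure_reducedSpan {μ : Vert Λ → ℝ} (hμ : ∀ a, 0 < μ a) :
    closure (reducedSpan Λ μ : Set (Fock Λ)) = Set.univ := by
  have hcl : IsClosed ((reducedSpan Λ μ).topologicalClosure : Set (Fock Λ)) := isClosed_closure
  have h1 (b : Vert Λ) (ξ : lp (fun _ : Walk b => ℂ) 2) :
      C0Sections.single b ξ ∈ (reducedSpan Λ μ).topologicalClosure := by
    refine hcl.mem_of_tendsto ((hasSum_basisVec ξ).mapL (C0Sections.single b))
      (Filter.Eventually.of_forall fun s => sum_mem fun w _ => ?_)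
    exact (reducedFiber μ b).smul_mem _ (basisVec_mem_reducedFiber hμ _ w (Nat.lt_succ_self _))
  refine Set.eq_univ_of_forall fun ξ => ?_
  exact hcl.mem_of_tendsto (C0Sections.hasSum_single ξ)
    (Filter.Eventually.of_forall fun s => sum_mem fun b _ => h1 b _)

/-! ### Assembly of the reduced free product -/

lemma leftAction_injective : Function.Injective (leftAction (Λ := Λ)) := fun c c' h => by
  ext a
  have h1 := expectation_apply (leftAction_mem_decaying (Λ := Λ) c) a
  have h2 := expectation_apply (leftAction_mem_decaying (Λ := Λ) c') a
  have h3 (c : C₀(Vert Λ, ℂ)) : vacuumVec (leftAction c) a (Walk.nil a) = c a := by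
    rw [vacuumVec_leftAction]
    change c a * basisVec (Walk.nil a) (Walk.nil a) = _
    rw [basisVec_self, mul_one]
  rw [← h3 c, ← h3 c', h]

lemma freeGraphAlgebra_eq_closure_adjoin (μ : Vert Λ → ℝ) :
    freeGraphAlgebra Λ μ = (NonUnitalStarAlgebra.adjoin ℂ
      (Set.range (leftAction (Λ := Λ)) ∪
        ⋃ e, (edgeAlgebra μ e : Set (FockOp Λ)))).topologicalClosure := by
  refine le_antisymm ?_ ?_
  · refine NonUnitalStarSubalgebra.topologicalClosure_minimal _
      (NonUnitalStarAlgebra.adjoin_le ?_) isClosed_closure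
    rintro _ (⟨c, rfl⟩ | ⟨e, rfl⟩)
    · exact subset_closure (NonUnitalStarAlgebra.subset_adjoin ℂ _ (Or.inl ⟨c, rfl⟩))
    · exact subset_closure (NonUnitalStarAlgebra.subset_adjoin ℂ _
        (Or.inr (Set.mem_iUnion.2 ⟨e, edgeOp_mem_edgeAlgebra μ e⟩)))
  · refine NonUnitalStarSubalgebra.topologicalClosure_minimal _
      (NonUnitalStarAlgebra.adjoin_le ?_) isClosed_closure
    rintro x (⟨c, rfl⟩ | hx)
    · exact leftAction_mem_freeGraphAlgebra μ c
    · obtain ⟨e, he⟩ := Set.mem_iUnion.1 hx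
      exact edgeAlgebra_le_freeGraphAlgebra μ e he

lemma inner_fockVec_nil (x : FockOp Λ) (hx : x ∈ decaying Λ) (b b' : C₀(Vert Λ, ℂ)) :
    ⟪fockVec [] b, x.1 (fockVec [] b')⟫_(C₀(Vert Λ, ℂ)) = star b * expectation x * b' := by
  ext a
  rw [fockVec_nil, fockVec_nil, inner_vacuum_apply, ZeroAtInftyContinuousMap.mul_apply,
    ZeroAtInftyContinuousMap.mul_apply, expectation_apply hx]
  rfl

/-- The module is the Fock space and the representation is the inclusion, hence faithful. The
substance lies in the inner products, which identify the Fock space with the free product module,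
and in the density of the reduced words. -/
lemma isReducedFreeProduct_freeGraphAlgebra {μ : Vert Λ → ℝ} (hμ : ∀ a, 0 < μ a) :
    IsReducedFreeProduct leftAction expectation (edgeAlgebra μ) (freeGraphAlgebra Λ μ) := by
  refine ⟨leftAction_injective, fun e => ⟨isClosed_closure, ?_⟩,
    freeGraphAlgebra_eq_closure_adjoin μ, isConditionalExpectationOn_expectation μ,
    Fock Λ, inferInstance, inferInstance, inferInstance, inferInstance, inferInstance, fockVec,
    fun w w' h h' b b' => inner_fockVec h h' b b', closure_reducedSpan hμ,
    NonUnitalStarSubalgebraClass.subtype (freeGraphAlgebra Λ μ), Subtype.val_injective, ?_, ?_, ?_⟩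
  · rintro _ ⟨c, rfl⟩
    exact leftAction_mem_edgeAlgebra μ e c
  · rintro c ⟨_, _⟩ rfl w _ b
    exact leftAction_fockVec c w b
  · rintro e x _ w _ b
    exact apply_fockVec e x w b
  · rintro x b b'
    exact inner_fockVec_nil x (mem_decaying x.2) b b'

end ReducedFreeProduct

end FreeGraph

end

theorem mainTheorem4 {α β : Type*} (Λ : Graph α β)
    (μ : FreeGraph.Vert Λ → ℝ) (hμ : ∀ a, 0 < μ a) :
    (∀ x ∈ FreeGraph.freeGraphAlgebra Λ μ, Summable (FreeGraph.expectationTerm x)) ∧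
    (∀ e : FreeGraph.Edge Λ,
      FreeGraph.IsFaithfulOn FreeGraph.expectation (FreeGraph.edgeAlgebra μ e)) ∧
    FreeGraph.IsFreeWithAmalgamation (FreeGraph.edgeAlgebra μ) FreeGraph.expectation ∧
    FreeGraph.IsFaithfulOn FreeGraph.expectation (FreeGraph.freeGraphAlgebra Λ μ) ∧
    FreeGraph.IsReducedFreeProduct FreeGraph.leftAction FreeGraph.expectation
      (FreeGraph.edgeAlgebra μ) (FreeGraph.freeGraphAlgebra Λ μ) := by
  -- Faithfulness on each `S_e` is inherited from the whole algebra.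
  refine ⟨fun x hx => ?_, fun e x hx => FreeGraph.isFaithfulOn_expectation hμ x
    (FreeGraph.edgeAlgebra_le_freeGraphAlgebra μ e hx),
    FreeGraph.isFreeWithAmalgamation_edgeAlgebra μ, FreeGraph.isFaithfulOn_expectation hμ,
    FreeGraph.isReducedFreeProduct_freeGraphAlgebra hμ⟩
  obtain ⟨_, _, h⟩ := FreeGraph.hasSum_expectationTerm (FreeGraph.mem_decaying hx)
  exact h.summable
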